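/- Let $\mathcal C$ be a braided monoidal category with braiding $\Psi$ in which idempotents split, and let $(H,m,\eta,\Delta,\varepsilon,S)$ be a Hopf algebra in $\mathcal C$ with invertible antipode $S$. (Associativity and unit constraints of $\mathcal C$ are suppressed below; $\mathcal C$ need not be strict.) An $H$-Hopf bimodule is an object $X$ with actions $\mu_l^X:H\otimes X\to X$, $\mu_r^X:X\otimes H\to X$ and coactions $\nu_l^X:X\to H\otimes X$, $\nu_r^X:X\to X\otimes H$ such that $X$ is an $H$-bimodule and an $H$-bicomodule and both coactions are bimodule morphisms, where $H$ carries the regular actions $m$ and tensor products carry the diagonal actions (e.g. $(\mu_r^X\otimes\mu_r^Y)\circ(\mathrm{id}_X\otimes\Psi_{Y,H}\otimes\mathrm{id}_H)\circ(\mathrm{id}_{X\otimes Y}\otimes\Delta)$ on the right). With the bimodule-bicomodule morphisms these form the category ${}^H_H\mathcal C^H_H$. For every Hopf bimodule $X$ the endomorphism ${}_X\Pi=\mu_l^X\circ(S\otimes\mathrm{id}_X)\circ\nu_l^X$ splits: there are an object ${}_HX$ and morphisms ${}_Xi:{}_HX\to X$, ${}_Xp:X\to{}_HX$ with ${}_Xi\circ{}_Xp={}_X\Pi$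 and ${}_Xp\circ{}_Xi=\mathrm{id}$. Fix any choice of such splittings, and equip ${}_HX$ with the right action ${}_Xp\circ\mu_r^X\circ({}_Xi\otimes\mathrm{id}_H)$ and the right coaction $({}_Xp\otimes\mathrm{id}_H)\circ\nu_r^X\circ{}_Xi$. Then the category ${}^H_H\mathcal C^H_H$ is braided monoidal, with the following structure. 1. The tensor product of $X$ and $Y$ is $X\otimes_HY:=X\otimes{}_HY$, which is a Hopf bimodule with left action $\mu_l^X\otimes\mathrm{id}$ and left coaction $\nu_l^X\otimes\mathrm{id}$ induced by $X$, with the diagonal right action, and with the diagonal right coaction $(\mathrm{id}\otimes\mathrm{id}\otimes m)\circ(\mathrm{id}\otimes\Psi_{H,{}_HY}\otimes\mathrm{id})\circ(\nu_r^X\otimes\nu_r^{{}_HY})$. On morphisms, $f\otimes_Hg=f\otimes({}_{Y'}p\circ g\circ{}_Yi)$ for $f:X\to X'$ and $g:Y\to Y'$. 2. The unit object is $H$ with its regular actions $m$ and coactions $\Delta$. 3. The constraints are the canonical ones: $(X\otimes_HY)\otimes_HZ\to X\otimes_H(Y\otimes_HZ)$ is $\mathrm{id}_X\otimes\big({}_{Y\otimes_HZ}p\circ({}_Yi\otimes\mathrm{id}_{{}_HZ})\big)$,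 $H\otimes_HX\to X$ is $\mu_l^X\circ(\mathrm{id}_H\otimes{}_Xi)$, and $X\otimes_HH\to X$ is $\mathrm{id}_X\otimes(\varepsilon\circ{}_Hi)$. 4. The braiding $X\otimes_HY\to Y\otimes_HX$ is $$(\mu_l^Y\otimes{}_Xp\circ\mu_r^X)\circ(\mathrm{id}_H\otimes\Psi_{X,Y}\otimes\mathrm{id}_H)\circ(\nu_l^X\otimes\nu_r^Y\circ{}_Yi).$$ -/

import Mathlib

open CategoryTheory MonoidalCategory

open scoped MonObj ComonObj HopfObj

universe v u

noncomputable section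

namespace BraidedHopf

section Actions

variable {C : Type u} [Category.{v} C] [MonoidalCategory C] [BraidedCategory C]
variable {H : C}

/-- The diagonal left action of `H` on `X ⊗ Y`. -/
def diagActL [HopfObj H] {X Y : C} (a : H ⊗ X ⟶ X) (b : H ⊗ Y ⟶ Y) :
    H ⊗ (X ⊗ Y) ⟶ X ⊗ Y :=
  Δ[H] ▷ (X ⊗ Y) ≫ tensorμ H H X Y ≫ (a ⊗ₘ b)

/-- The diagonal right action of `H` on `X ⊗ Y`. -/
def diagActR [HopfObj H] {X Y : C} (a : X ⊗ H ⟶ X) (b : Y ⊗ H ⟶ Y) :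
    (X ⊗ Y) ⊗ H ⟶ X ⊗ Y :=
  (X ⊗ Y) ◁ Δ[H] ≫ tensorμ X Y H H ≫ (a ⊗ₘ b)

/-- The diagonal right coaction of `H` on `X ⊗ Y`. -/
def diagCoactR [HopfObj H] {X Y : C} (a : X ⟶ X ⊗ H) (b : Y ⟶ Y ⊗ H) :
    X ⊗ Y ⟶ (X ⊗ Y) ⊗ H :=
  (a ⊗ₘ b) ≫ tensorμ X H Y H ≫ (X ⊗ Y) ◁ μ[H]

end Actions

section HopfBimodules

variable {C : Type u} [Category.{v} C] [MonoidalCategory C]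

/-- An object with left and right actions and coactions of `H`, no axioms imposed. -/
structure HopfBimodData (H : C) where
  /-- The underlying object. -/
  pt : C
  /-- The left action. -/
  actL : H ⊗ pt ⟶ pt
  /-- The right action. -/
  actR : pt ⊗ H ⟶ pt
  /-- The left coaction. -/
  coactL : pt ⟶ H ⊗ pt
  /-- The right coaction. -/
  coactR : pt ⟶ pt ⊗ H

variable [BraidedCategory C]

/-- `X` is an `H`-bimodule and an `H`-bicomodule, and both coactions are morphisms of bimodules,
where `H` carries the regular actions and `H ⊗ X`, `X ⊗ H` the diagonal ones. -/
structure HopfBimodData.IsHopfBimodule {H : C} [HopfObj H] (X : HopfBimodData H) : Prop where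
  one_actL : η[H] ▷ X.pt ≫ X.actL = (λ_ X.pt).hom
  mul_actL : μ[H] ▷ X.pt ≫ X.actL = (α_ H H X.pt).hom ≫ H ◁ X.actL ≫ X.actL
  actR_one : X.pt ◁ η[H] ≫ X.actR = (ρ_ X.pt).hom
  actR_mul : X.pt ◁ μ[H] ≫ X.actR = (α_ X.pt H H).inv ≫ X.actR ▷ H ≫ X.actR
  actL_actR : X.actL ▷ H ≫ X.actR = (α_ H X.pt H).hom ≫ H ◁ X.actR ≫ X.actL
  coactL_counit : X.coactL ≫ ε[H] ▷ X.pt = (λ_ X.pt).inv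
  coactL_comul : X.coactL ≫ Δ[H] ▷ X.pt =
    X.coactL ≫ H ◁ X.coactL ≫ (α_ H H X.pt).inv
  coactR_counit : X.coactR ≫ X.pt ◁ ε[H] = (ρ_ X.pt).inv
  coactR_comul : X.coactR ≫ X.pt ◁ Δ[H] =
    X.coactR ≫ X.coactR ▷ H ≫ (α_ X.pt H H).hom
  coactL_coactR : X.coactR ≫ X.coactL ▷ H =
    X.coactL ≫ H ◁ X.coactR ≫ (α_ H X.pt H).inv
  actL_coactL : X.actL ≫ X.coactL = H ◁ X.coactL ≫ diagActL μ[H] X.actL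
  actR_coactL : X.actR ≫ X.coactL = X.coactL ▷ H ≫ diagActR μ[H] X.actR
  actL_coactR : X.actL ≫ X.coactR = H ◁ X.coactR ≫ diagActL X.actL μ[H]
  actR_coactR : X.actR ≫ X.coactR = X.coactR ▷ H ≫ diagActR X.actR μ[H]

/-- An `H`-Hopf bimodule. -/
structure HopfBimodule (H : C) [HopfObj H] extends HopfBimodData H where
  isHopfBimodule : toHopfBimodData.IsHopfBimodule

/-- A bimodule and bicomodule morphism. -/
@[ext]
structure HopfBimodule.Hom {H : C} [HopfObj H] (X Y : HopfBimodule H) where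
  /-- The underlying morphism. -/
  hom : X.pt ⟶ Y.pt
  actL_hom : X.actL ≫ hom = H ◁ hom ≫ Y.actL
  actR_hom : X.actR ≫ hom = hom ▷ H ≫ Y.actR
  hom_coactL : hom ≫ Y.coactL = X.coactL ≫ H ◁ hom
  hom_coactR : hom ≫ Y.coactR = X.coactR ≫ hom ▷ H

/-- The category of `H`-Hopf bimodules. -/
instance HopfBimodule.instCategory {H : C} [HopfObj H] : Category.{v} (HopfBimodule H) where
  Hom X Y := HopfBimodule.Hom X Y
  id X := ⟨𝟙 X.pt, by simp, by simp, by simp, by simp⟩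
  comp f g := ⟨f.hom ≫ g.hom,
    by rw [← Category.assoc, f.actL_hom, Category.assoc, g.actL_hom]; simp,
    by rw [← Category.assoc, f.actR_hom, Category.assoc, g.actR_hom]; simp,
    by rw [Category.assoc, g.hom_coactL, ← Category.assoc, f.hom_coactL]; simp,
    by rw [Category.assoc, g.hom_coactR, ← Category.assoc, f.hom_coactR]; simp⟩
  id_comp f := HopfBimodule.Hom.ext (Category.id_comp f.hom)
  comp_id f := HopfBimodule.Hom.ext (Category.comp_id f.hom)
  assoc f g h := HopfBimodule.Hom.ext (Category.assoc f.hom g.hom h.hom)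

/-- `H` with its regular actions and coactions. -/
def HopfBimodule.regular (H : C) [HopfObj H] : HopfBimodule H where
  pt := H
  actL := μ[H]
  actR := μ[H]
  coactL := Δ[H]
  coactR := Δ[H]
  isHopfBimodule := by
    have h : μ[H] ≫ Δ[H] = H ◁ Δ[H] ≫ Δ[H] ▷ (H ⊗ H) ≫ tensorμ H H H H ≫ (μ[H] ⊗ₘ μ[H]) := by
      rw [BimonObj.mul_comul, MonoidalCategory.tensorHom_def', Category.assoc]
    have h' : μ[H] ≫ Δ[H] = Δ[H] ▷ H ≫ (H ⊗ H) ◁ Δ[H] ≫ tensorμ H H H H ≫ (μ[H] ⊗ₘ μ[H]) := by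
      rw [BimonObj.mul_comul, MonoidalCategory.tensorHom_def, Category.assoc]
    constructor <;> first | exact h | exact h' | simp

/-- The endomorphism `Π = μ_l ∘ (S ⊗ id) ∘ ν_l` of a Hopf bimodule. -/
def HopfBimodule.proj {H : C} [HopfObj H] (X : HopfBimodule H) : X.pt ⟶ X.pt :=
  X.coactL ≫ 𝒮[H] ▷ X.pt ≫ X.actL

/-- A splitting of the endomorphism `Π` of `X`, with the object of invariants `inv`. -/
structure InvariantSplitting {H : C} [HopfObj H] (X : HopfBimodule H) where
  /-- The object of invariants. -/
  inv : C
  /-- The inclusion of the invariants. -/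
  i : inv ⟶ X.pt
  /-- The projection to the invariants. -/
  p : X.pt ⟶ inv
  p_i : p ≫ i = X.proj
  i_p : i ≫ p = 𝟙 inv

namespace InvariantSplitting

variable {H : C} [HopfObj H] {X : HopfBimodule H}

/-- The right action on the invariants. -/
def act (s : InvariantSplitting X) : s.inv ⊗ H ⟶ s.inv :=
  s.i ▷ H ≫ X.actR ≫ s.p

/-- The right coaction on the invariants. -/
def coact (s : InvariantSplitting X) : s.inv ⟶ s.inv ⊗ H :=
  s.i ≫ X.coactR ≫ s.p ▷ H

end InvariantSplitting

/-- The object `X ⊗ inv Y` with the left action and coaction induced by `X` and the diagonal right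
action and coaction. -/
def tensorData {H : C} [HopfObj H] (X : HopfBimodule H) {Y : HopfBimodule H}
    (s : InvariantSplitting Y) : HopfBimodData H where
  pt := X.pt ⊗ s.inv
  actL := (α_ H X.pt s.inv).inv ≫ X.actL ▷ s.inv
  actR := diagActR X.actR s.act
  coactL := X.coactL ▷ s.inv ≫ (α_ H X.pt s.inv).hom
  coactR := diagCoactR X.coactR s.coact

/-- A unit object, tensor product, associativity and unit constraints and a braiding on Hopf
bimodules; the value of the tensor product on morphisms and the constraints are recorded by their
underlying morphisms, which determine them. -/
structure BraidedTensorData (H : C) [HopfObj H] where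
  /-- The unit object. -/
  unit : HopfBimodule H
  /-- The tensor product of objects. -/
  tensorObj : HopfBimodule H → HopfBimodule H → HopfBimodule H
  /-- The tensor product of morphisms. -/
  tensorHom : ∀ {X X' Y Y' : HopfBimodule H}, (X ⟶ X') → (Y ⟶ Y') →
    ((tensorObj X Y).pt ⟶ (tensorObj X' Y').pt)
  /-- The associativity constraint. -/
  associator : ∀ X Y Z : HopfBimodule H,
    (tensorObj (tensorObj X Y) Z).pt ⟶ (tensorObj X (tensorObj Y Z)).pt
  /-- The left unit constraint. -/
  leftUnitor : ∀ X : HopfBimodule H, (tensorObj unit X).pt ⟶ X.pt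
  /-- The right unit constraint. -/
  rightUnitor : ∀ X : HopfBimodule H, (tensorObj X unit).pt ⟶ X.pt
  /-- The braiding. -/
  braiding : ∀ X Y : HopfBimodule H, (tensorObj X Y).pt ⟶ (tensorObj Y X).pt

/-- The data contained in a braided monoidal structure on the category of Hopf bimodules. -/
def BraidedTensorData.of {H : C} [HopfObj H] (M : MonoidalCategory (HopfBimodule H))
    (_ : BraidedCategory (HopfBimodule H)) : BraidedTensorData H where
  unit := 𝟙_ (HopfBimodule H)
  tensorObj X Y := X ⊗ Y
  tensorHom f g := (f ⊗ₘ g).hom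
  associator X Y Z := (α_ X Y Z).hom.hom
  leftUnitor X := (λ_ X).hom.hom
  rightUnitor X := (ρ_ X).hom.hom
  braiding X Y := (β_ X Y).hom.hom

/-- The tensor product `X ⊗ inv Y` of Hopf bimodules, with unit `H`, the canonical constraints and
the braiding
`(μ_l ⊗ p ∘ μ_r) ∘ (id ⊗ Ψ ⊗ id) ∘ (ν_l ⊗ ν_r ∘ i)`, for chosen splittings of the `Π`. -/
def BraidedTensorData.hopf {H : C} [HopfObj H] (s : ∀ X : HopfBimodule H, InvariantSplitting X)
    (hT : ∀ X Y : HopfBimodule H, (tensorData X (s Y)).IsHopfBimodule) :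
    BraidedTensorData H where
  unit := HopfBimodule.regular H
  tensorObj X Y := ⟨tensorData X (s Y), hT X Y⟩
  tensorHom {_ _ Y Y'} f g := f.hom ⊗ₘ ((s Y).i ≫ g.hom ≫ (s Y').p)
  associator X Y Z := (α_ X.pt (s Y).inv (s Z).inv).hom ≫
    X.pt ◁ ((s Y).i ▷ (s Z).inv ≫ (s ⟨tensorData Y (s Z), hT Y Z⟩).p)
  leftUnitor X := H ◁ (s X).i ≫ X.actL
  rightUnitor X := X.pt ◁ ((s (HopfBimodule.regular H)).i ≫ ε[H]) ≫ (ρ_ X.pt).hom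
  braiding X Y := (X.coactL ⊗ₘ ((s Y).i ≫ Y.coactR)) ≫ tensorμ H X.pt Y.pt H ≫
    (Y.actL ⊗ₘ (X.actR ≫ (s X).p))

end HopfBimodules

end BraidedHopf

end

/-!
# Braided monoidal categories of Hopf bimodules

A Hopf bimodule `X` is free as a left module over its invariants `inv X`, the image of the
idempotent `Π = actL ∘ (S ⊗ id) ∘ coactL`: the morphism `H ⊗ inv X ⟶ X`, `h ⊗ v ↦ h v`, is
invertible (`InvariantSplitting.leftUnitorIso`). The right action and coaction of `X` induce on
`inv X` the structure of a right crossed module, that is, of a Yetter-Drinfeld module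
(`InvariantSplitting.isCrossed`). Conversely `X ⊗ V` is a Hopf bimodule for every Hopf bimodule `X`
and every crossed module `V` (`isHopfBimodule_tensor`); in particular `X ⊗ inv Y` is one.

By freeness, restriction to the invariants is a faithful functor, and its image on morphisms
consists of all morphisms of crossed modules (`InvariantSplitting.map_injective`,
`InvariantSplitting.isCrossedHom_map`, `InvariantSplitting.map_lift`). The invariants of `X ⊗ V` are
`inv X ⊗ V`, with the diagonal action and coaction (`InvariantSplitting.tensorIso`,
`InvariantSplitting.isCrossedHom_tensorIso_inv`), and the invariants of `H` are the unit object
(`InvariantSplitting.unitIso`). These isomorphisms turn the proposed constraints into the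
constraints of `C`, so the axioms of a monoidal category are inherited from `C` along the faithful
functor `HopfBimodule.invariants` (`HopfBimodule.inducingFunctorData`).

The braiding is obtained in the same way. Crossed modules are braided by `v ⊗ w ↦ w₀ ⊗ (v ◁ w₁)`
(`crossBraid`), which is compatible with the diagonal structures by the crossed module law,
satisfies the two hexagon identities because actions and coactions are associative
(`crossBraid_diagActR`, `crossBraid_diagCoactR`), and is invertible because the inverse of the
antipode is an antipode for the opposite multiplication (`crossBraidIso`). It lifts to Hopf
bimodules, where it is given by the formula of `InvariantSplitting.braidIso_hom_hom`.

Equations between morphisms built from actions, coactions and braidings are proved after tensoring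
with an arbitrary object `Z` on the right, with all tensor products associated to the right. An
operation on the first factors is then one of `mulAt`, `comulAt`, `oneAt`, `counitAt` and `braidAt`,
an operation on later factors is such a morphism whiskered on the left, and no associators appear.
Lemmas whose names end in `_at` are equations of this form, the lemmas `assoc_iff`, `coassoc_iff`,
`diagL_iff`, and so on, translate them, and a lemma `foo_assoc` is `foo` composed with a further
morphism.
-/

noncomputable section

namespace BraidedHopf

/-! ### Structure morphisms applied to the first tensor factors -/

section Tails

variable {C : Type u} [Category.{v} C] [MonoidalCategory C]

/-- A morphism `A ⊗ B ⟶ D` applied to the first two factors of `A ⊗ (B ⊗ Z)`. -/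
def mulAt {A B D : C} (g : A ⊗ B ⟶ D) (Z : C) : A ⊗ (B ⊗ Z) ⟶ D ⊗ Z :=
  (α_ A B Z).inv ≫ g ▷ Z

/-- A morphism `A ⟶ B ⊗ D` applied to the first factor of `A ⊗ Z`. -/
def comulAt {A B D : C} (g : A ⟶ B ⊗ D) (Z : C) : A ⊗ Z ⟶ B ⊗ (D ⊗ Z) :=
  g ▷ Z ≫ (α_ B D Z).hom

/-- A morphism `𝟙_ C ⟶ A` inserted in front of `Z`. -/
def oneAt {A : C} (g : 𝟙_ C ⟶ A) (Z : C) : Z ⟶ A ⊗ Z :=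
  (λ_ Z).inv ≫ g ▷ Z

/-- A morphism `A ⟶ 𝟙_ C` applied to the first factor of `A ⊗ Z`. -/
def counitAt {A : C} (g : A ⟶ 𝟙_ C) (Z : C) : A ⊗ Z ⟶ Z :=
  g ▷ Z ≫ (λ_ Z).hom

/-- Whiskering with the unit object loses nothing; this recovers an equation from its form with an
arbitrary object on the right. -/
theorem eq_of_whiskerRight_unit {A B : C} {f g : A ⟶ B} (h : f ▷ 𝟙_ C = g ▷ 𝟙_ C) : f = g := by
  simpa using h

theorem mulAt_nat {A B D Z W : C} (g : A ⊗ B ⟶ D) (f : Z ⟶ W) :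
    mulAt g Z ≫ D ◁ f = A ◁ B ◁ f ≫ mulAt g W := by
  simp [mulAt, ← whisker_exchange]

theorem mulAt_nat_assoc : type_of% (reassoc_of% @mulAt_nat) :=
  @(reassoc_of% @mulAt_nat)

theorem comulAt_nat {A B D Z W : C} (g : A ⟶ B ⊗ D) (f : Z ⟶ W) :
    comulAt g Z ≫ B ◁ D ◁ f = A ◁ f ≫ comulAt g W := by
  simp [comulAt, whisker_exchange_assoc]

theorem comulAt_nat_assoc : type_of% (reassoc_of% @comulAt_nat) :=
  @(reassoc_of% @comulAt_nat)

theorem oneAt_nat {A Z W : C} (g : 𝟙_ C ⟶ A) (f : Z ⟶ W) :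
    oneAt g Z ≫ A ◁ f = f ≫ oneAt g W := by
  simp [oneAt, ← whisker_exchange]

theorem oneAt_nat_assoc : type_of% (reassoc_of% @oneAt_nat) :=
  @(reassoc_of% @oneAt_nat)

theorem counitAt_nat {A Z W : C} (g : A ⟶ 𝟙_ C) (f : Z ⟶ W) :
    counitAt g Z ≫ f = A ◁ f ≫ counitAt g W := by
  simp [counitAt, whisker_exchange_assoc]

theorem counitAt_nat_assoc : type_of% (reassoc_of% @counitAt_nat) :=
  @(reassoc_of% @counitAt_nat)

theorem assoc_iff {A B B' D D' E : C} {m : B ⊗ B' ⟶ D} {a : A ⊗ D ⟶ E} {a' : A ⊗ B ⟶ D'}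
    {a'' : D' ⊗ B' ⟶ E} :
    A ◁ m ≫ a = (α_ A B B').inv ≫ a' ▷ B' ≫ a'' ↔
      ∀ Z, A ◁ mulAt m Z ≫ mulAt a Z = mulAt a' (B' ⊗ Z) ≫ mulAt a'' Z := by
  constructor
  · intro h Z
    have := congr(A ◁ (α_ _ _ _).inv ≫ (α_ _ _ _).inv ≫ $h ▷ Z)
    simpa [mulAt] using this
  · intro h
    apply eq_of_whiskerRight_unit
    have := congr((α_ _ _ _).hom ≫ A ◁ (α_ _ _ _).hom ≫ $(h (𝟙_ C)))
    simpa [mulAt] using this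

theorem coassoc_iff {A B B' D D' E : C} {m : D ⟶ B ⊗ B'} {a : E ⟶ A ⊗ D} {a' : D' ⟶ A ⊗ B}
    {a'' : E ⟶ D' ⊗ B'} :
    a ≫ A ◁ m = a'' ≫ a' ▷ B' ≫ (α_ A B B').hom ↔
      ∀ Z, comulAt a Z ≫ A ◁ comulAt m Z = comulAt a'' Z ≫ comulAt a' (B' ⊗ Z) := by
  constructor
  · intro h Z
    have := congr($h ▷ Z ≫ (α_ _ _ _).hom ≫ A ◁ (α_ _ _ _).hom)
    simpa [comulAt] using this
  · intro h
    apply eq_of_whiskerRight_unit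
    have := congr($(h (𝟙_ C)) ≫ A ◁ (α_ _ _ _).inv ≫ (α_ _ _ _).inv)
    simpa [comulAt] using this

theorem one_mul_iff {A B : C} {e : 𝟙_ C ⟶ A} {a : A ⊗ B ⟶ B} :
    e ▷ B ≫ a = (λ_ B).hom ↔ ∀ Z, oneAt e (B ⊗ Z) ≫ mulAt a Z = 𝟙 _ := by
  constructor
  · intro h Z
    have := congr((λ_ _).inv ≫ (α_ _ _ _).inv ≫ $h ▷ Z)
    simpa [mulAt, oneAt] using this
  · intro h
    apply eq_of_whiskerRight_unit
    calc (e ▷ B ≫ a) ▷ 𝟙_ C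
        = (α_ _ _ _).hom ≫ (λ_ _).hom ≫ oneAt e (B ⊗ 𝟙_ C) ≫ mulAt a (𝟙_ C) := by
          simp only [oneAt, mulAt]; monoidal
      _ = _ := by rw [h]; monoidal

theorem mul_one_iff {A B : C} {e : 𝟙_ C ⟶ A} {a : B ⊗ A ⟶ B} :
    B ◁ e ≫ a = (ρ_ B).hom ↔ ∀ Z, B ◁ oneAt e Z ≫ mulAt a Z = 𝟙 _ := by
  constructor
  · intro h Z
    have := congr(B ◁ (λ_ _).inv ≫ (α_ _ _ _).inv ≫ $h ▷ Z)
    simpa [mulAt, oneAt] using this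
  · intro h
    apply eq_of_whiskerRight_unit
    have := congr((α_ _ _ _).hom ≫ B ◁ (λ_ _).hom ≫ $(h (𝟙_ C)))
    simpa [mulAt, oneAt] using this

theorem counit_comul_iff {A B : C} {e : A ⟶ 𝟙_ C} {a : B ⟶ A ⊗ B} :
    a ≫ e ▷ B = (λ_ B).inv ↔ ∀ Z, comulAt a Z ≫ counitAt e (B ⊗ Z) = 𝟙 _ := by
  constructor
  · intro h Z
    have := congr($h ▷ Z ≫ (α_ _ _ _).hom ≫ (λ_ _).hom)
    simpa [comulAt, counitAt] using this
  · intro h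
    apply eq_of_whiskerRight_unit
    calc (a ≫ e ▷ B) ▷ 𝟙_ C
        = (comulAt a (𝟙_ C) ≫ counitAt e (B ⊗ 𝟙_ C)) ≫ (λ_ _).inv ≫ (α_ _ _ _).inv := by
          simp only [comulAt, counitAt]; monoidal
      _ = _ := by rw [h]; monoidal

theorem comul_counit_iff {A B : C} {e : A ⟶ 𝟙_ C} {a : B ⟶ B ⊗ A} :
    a ≫ B ◁ e = (ρ_ B).inv ↔ ∀ Z, comulAt a Z ≫ B ◁ counitAt e Z = 𝟙 _ := by
  constructor
  · intro h Z
    have := congr($h ▷ Z ≫ (α_ _ _ _).hom ≫ B ◁ (λ_ _).hom)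
    simpa [comulAt, counitAt] using this
  · intro h
    apply eq_of_whiskerRight_unit
    have := congr($(h (𝟙_ C)) ≫ B ◁ (λ_ _).inv ≫ (α_ _ _ _).inv)
    simpa [comulAt, counitAt] using this

theorem whiskerRight_actL_at {H X V : C} (a : H ⊗ X ⟶ X) (Z : C) :
    mulAt ((α_ H X V).inv ≫ a ▷ V) Z =
      H ◁ (α_ _ _ _).hom ≫ mulAt a (V ⊗ Z) ≫ (α_ _ _ _).inv := by
  simp [mulAt]

theorem whiskerRight_coactL_at {H X V : C} (c : X ⟶ H ⊗ X) (Z : C) :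
    comulAt (c ▷ V ≫ (α_ H X V).hom) Z =
      (α_ _ _ _).hom ≫ comulAt c (V ⊗ Z) ≫ H ◁ (α_ _ _ _).inv := by
  simp [comulAt]

theorem actL_tensorHom {K X Y V W : C} {a : K ⊗ X ⟶ X} {b : K ⊗ Y ⟶ Y} {f : X ⟶ Y}
    (h : a ≫ f = K ◁ f ≫ b) (φ : V ⟶ W) :
    ((α_ K X V).inv ≫ a ▷ V) ≫ (f ⊗ₘ φ) = K ◁ (f ⊗ₘ φ) ≫ (α_ K Y W).inv ≫ b ▷ W := by
  simp only [MonoidalCategory.tensorHom_def]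
  rw [Category.assoc, ← comp_whiskerRight_assoc, h]
  rw [comp_whiskerRight, Category.assoc, ← whisker_exchange]
  simp

theorem tensorHom_coactL {K X Y V W : C} {a : X ⟶ K ⊗ X} {b : Y ⟶ K ⊗ Y} {f : X ⟶ Y}
    (h : f ≫ b = a ≫ K ◁ f) (φ : V ⟶ W) :
    (f ⊗ₘ φ) ≫ b ▷ W ≫ (α_ K Y W).hom = (a ▷ V ≫ (α_ K X V).hom) ≫ K ◁ (f ⊗ₘ φ) := by
  simp only [MonoidalCategory.tensorHom_def']
  rw [Category.assoc, ← comp_whiskerRight_assoc, h]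
  simp [whisker_exchange_assoc]

theorem actL_comp_iff {K V W : C} {a : K ⊗ V ⟶ V} {a' : K ⊗ W ⟶ W} {f : V ⟶ W} :
    a ≫ f = K ◁ f ≫ a' ↔ ∀ Z, mulAt a Z ≫ f ▷ Z = K ◁ f ▷ Z ≫ mulAt a' Z := by
  constructor
  · intro h Z
    have := congr((α_ _ _ _).inv ≫ $h ▷ Z)
    simpa [mulAt] using this
  · intro h
    apply eq_of_whiskerRight_unit
    have := congr((α_ _ _ _).hom ≫ $(h (𝟙_ C)))
    simpa [mulAt] using this

theorem comp_coactL_iff {K V W : C} {c : V ⟶ K ⊗ V} {c' : W ⟶ K ⊗ W} {f : V ⟶ W} :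
    f ≫ c' = c ≫ K ◁ f ↔ ∀ Z, f ▷ Z ≫ comulAt c' Z = comulAt c Z ≫ K ◁ f ▷ Z := by
  constructor
  · intro h Z
    have := congr($h ▷ Z ≫ (α_ _ _ _).hom)
    simpa [comulAt] using this
  · intro h
    apply eq_of_whiskerRight_unit
    have := congr($(h (𝟙_ C)) ≫ (α_ _ _ _).inv)
    simpa [comulAt] using this

theorem associator_whiskerRight (A B D Z : C) : (α_ A B D).hom ▷ Z =
    (α_ _ _ _).hom ≫ (α_ _ _ _).hom ≫ A ◁ (α_ _ _ _).inv ≫ (α_ _ _ _).inv := by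
  monoidal

variable [BraidedCategory C]

/-- The braiding of the first two factors of `A ⊗ (B ⊗ Z)`. -/
def braidAt (A B Z : C) : A ⊗ (B ⊗ Z) ⟶ B ⊗ (A ⊗ Z) :=
  (α_ A B Z).inv ≫ (β_ A B).hom ▷ Z ≫ (α_ B A Z).hom

theorem braidAt_nat (A B : C) {Z W : C} (f : Z ⟶ W) :
    braidAt A B Z ≫ B ◁ A ◁ f = A ◁ B ◁ f ≫ braidAt A B W := by
  simp only [braidAt, Category.assoc, ← associator_naturality_right, ← whisker_exchange_assoc]
  simp

theorem braidAt_nat_assoc : type_of% (reassoc_of% @braidAt_nat) :=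
  @(reassoc_of% @braidAt_nat)

theorem whiskerRight_braidAt {A B : C} (f : A ⟶ B) (K Z : C) :
    f ▷ (K ⊗ Z) ≫ braidAt B K Z = braidAt A K Z ≫ K ◁ f ▷ Z := by
  have := congr($(BraidedCategory.braiding_naturality_left f K) ▷ Z ≫ (α_ _ _ _).hom)
  simpa [braidAt, -BraidedCategory.braiding_naturality_left] using this

theorem whiskerRight_braidAt_assoc : type_of% (reassoc_of% @whiskerRight_braidAt) :=
  @(reassoc_of% @whiskerRight_braidAt)

theorem whiskerLeft_whiskerRight_braidAt {A B : C} (f : A ⟶ B) (K Z : C) :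
    K ◁ f ▷ Z ≫ braidAt K B Z = braidAt K A Z ≫ f ▷ (K ⊗ Z) := by
  have := congr((α_ _ _ _).inv ≫ $(BraidedCategory.braiding_naturality_right K f) ▷ Z ≫
    (α_ _ _ _).hom)
  simpa [braidAt, -BraidedCategory.braiding_naturality_right] using this

theorem whiskerLeft_whiskerRight_braidAt_assoc :
    type_of% (reassoc_of% @whiskerLeft_whiskerRight_braidAt) :=
  @(reassoc_of% @whiskerLeft_whiskerRight_braidAt)

theorem braidAt_tensor_left (A B K Z : C) : braidAt (A ⊗ B) K Z =
    (α_ _ _ _).hom ≫ A ◁ braidAt B K Z ≫ braidAt A K (B ⊗ Z) ≫ K ◁ (α_ _ _ _).inv := by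
  simp [braidAt]

theorem braidAt_tensor_right (A B K Z : C) : braidAt K (A ⊗ B) Z =
    K ◁ (α_ _ _ _).hom ≫ braidAt K A (B ⊗ Z) ≫ A ◁ braidAt K B Z ≫ (α_ _ _ _).inv := by
  simp [braidAt]

theorem braidAt_unit_left (K Z : C) : braidAt (𝟙_ C) K Z =
    (λ_ _).hom ≫ K ◁ (λ_ _).inv := by
  simp [braidAt]

theorem braidAt_unit_right (K Z : C) : braidAt K (𝟙_ C) Z =
    K ◁ (λ_ _).hom ≫ (λ_ _).inv := by
  simp [braidAt]

theorem mulAt_braidAt {A B D : C} (g : A ⊗ B ⟶ D) (K Z : C) :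
    mulAt g (K ⊗ Z) ≫ braidAt D K Z =
      A ◁ braidAt B K Z ≫ braidAt A K (B ⊗ Z) ≫ K ◁ mulAt g Z := by
  simp [mulAt, whiskerRight_braidAt, -whiskerRight_tensor, braidAt_tensor_left]

theorem mulAt_braidAt_assoc : type_of% (reassoc_of% @mulAt_braidAt) :=
  @(reassoc_of% @mulAt_braidAt)

theorem whiskerLeft_mulAt_braidAt {A B D : C} (g : A ⊗ B ⟶ D) (K Z : C) :
    K ◁ mulAt g Z ≫ braidAt K D Z =
      braidAt K A (B ⊗ Z) ≫ A ◁ braidAt K B Z ≫ mulAt g (K ⊗ Z) := by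
  simp [mulAt, whiskerLeft_whiskerRight_braidAt, -whiskerRight_tensor, braidAt_tensor_right]

theorem whiskerLeft_mulAt_braidAt_assoc : type_of% (reassoc_of% @whiskerLeft_mulAt_braidAt) :=
  @(reassoc_of% @whiskerLeft_mulAt_braidAt)

theorem braidAt_comulAt {A B D : C} (g : D ⟶ A ⊗ B) (K Z : C) :
    braidAt K D Z ≫ comulAt g (K ⊗ Z) =
      K ◁ comulAt g Z ≫ braidAt K A (B ⊗ Z) ≫ A ◁ braidAt K B Z := by
  simp [comulAt, ← whiskerLeft_whiskerRight_braidAt_assoc, -whiskerRight_tensor,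
    braidAt_tensor_right]

theorem braidAt_comulAt_assoc : type_of% (reassoc_of% @braidAt_comulAt) :=
  @(reassoc_of% @braidAt_comulAt)

theorem braidAt_whiskerLeft_comulAt {A B D : C} (g : D ⟶ A ⊗ B) (K Z : C) :
    braidAt D K Z ≫ K ◁ comulAt g Z =
      comulAt g (K ⊗ Z) ≫ A ◁ braidAt B K Z ≫ braidAt A K (B ⊗ Z) := by
  simp [comulAt, ← whiskerRight_braidAt_assoc, -whiskerRight_tensor, braidAt_tensor_left]

theorem braidAt_whiskerLeft_comulAt_assoc : type_of% (reassoc_of% @braidAt_whiskerLeft_comulAt) :=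
  @(reassoc_of% @braidAt_whiskerLeft_comulAt)

theorem whiskerLeft_oneAt_braidAt {D : C} (g : 𝟙_ C ⟶ D) (K Z : C) :
    K ◁ oneAt g Z ≫ braidAt K D Z = oneAt g (K ⊗ Z) := by
  simp [oneAt, whiskerLeft_whiskerRight_braidAt, -whiskerRight_tensor, braidAt_unit_right]

theorem whiskerLeft_oneAt_braidAt_assoc : type_of% (reassoc_of% @whiskerLeft_oneAt_braidAt) :=
  @(reassoc_of% @whiskerLeft_oneAt_braidAt)

theorem braidAt_counitAt {D : C} (g : D ⟶ 𝟙_ C) (K Z : C) :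
    braidAt K D Z ≫ counitAt g (K ⊗ Z) = K ◁ counitAt g Z := by
  simp [counitAt, ← whiskerLeft_whiskerRight_braidAt_assoc, -whiskerRight_tensor,
    braidAt_unit_right]

theorem braidAt_counitAt_assoc : type_of% (reassoc_of% @braidAt_counitAt) :=
  @(reassoc_of% @braidAt_counitAt)

theorem braidAt_whiskerLeft_counitAt {D : C} (g : D ⟶ 𝟙_ C) (K Z : C) :
    braidAt D K Z ≫ K ◁ counitAt g Z = counitAt g (K ⊗ Z) := by
  simp [counitAt, ← whiskerRight_braidAt_assoc, -whiskerRight_tensor, braidAt_unit_left]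

theorem braidAt_whiskerLeft_counitAt_assoc : type_of% (reassoc_of% @braidAt_whiskerLeft_counitAt) :=
  @(reassoc_of% @braidAt_whiskerLeft_counitAt)

theorem yang_baxter_at (A B D Z : C) :
    A ◁ braidAt B D Z ≫ braidAt A D (B ⊗ Z) ≫ D ◁ braidAt A B Z =
      braidAt A B (D ⊗ Z) ≫ B ◁ braidAt A D Z ≫ braidAt B D (A ⊗ Z) := by
  have := whiskerLeft_whiskerRight_braidAt (β_ B D).hom A Z
  rw [braidAt_tensor_right, braidAt_tensor_right] at this
  have h := congr(A ◁ (α_ _ _ _).inv ≫ $this ≫ (α_ _ _ _).hom)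
  simpa [braidAt] using h

theorem yang_baxter_at_assoc : type_of% (reassoc_of% @yang_baxter_at) :=
  @(reassoc_of% @yang_baxter_at)

/-- Compatibility of an action with a coaction, for a diagonal left action. The right-hand side is
the same as in `diagR_iff`, since `c'` and `d` are applied to different factors. -/
theorem diagL_iff {A B D E F A₁ A₂ Y₁ Y₂ : C} {a : A ⊗ B ⟶ D} {c : D ⟶ E ⊗ F} {d : A ⟶ A₁ ⊗ A₂}
    {c' : B ⟶ Y₁ ⊗ Y₂} {m₁ : A₁ ⊗ Y₁ ⟶ E} {m₂ : A₂ ⊗ Y₂ ⟶ F} :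
    a ≫ c = A ◁ c' ≫ d ▷ (Y₁ ⊗ Y₂) ≫ tensorμ A₁ A₂ Y₁ Y₂ ≫ (m₁ ⊗ₘ m₂) ↔
      ∀ Z, mulAt a Z ≫ comulAt c Z = A ◁ comulAt c' Z ≫ comulAt d (Y₁ ⊗ (Y₂ ⊗ Z)) ≫
        A₁ ◁ braidAt A₂ Y₁ (Y₂ ⊗ Z) ≫ mulAt m₁ (A₂ ⊗ (Y₂ ⊗ Z)) ≫ E ◁ mulAt m₂ Z := by
  constructor
  · intro h Z
    have := congr((α_ _ _ _).inv ≫ $h ▷ Z ≫ (α_ _ _ _).hom)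
    simp only [tensorμ, MonoidalCategory.tensorHom_def] at this
    simpa [mulAt, comulAt, braidAt] using this
  · intro h
    apply eq_of_whiskerRight_unit
    have := congr((α_ _ _ _).hom ≫ $(h (𝟙_ C)) ≫ (α_ _ _ _).inv)
    simp only [tensorμ, MonoidalCategory.tensorHom_def]
    simpa [mulAt, comulAt, braidAt] using this

theorem diagR_iff {A B D E F A₁ A₂ Y₁ Y₂ : C} {a : A ⊗ B ⟶ D} {c : D ⟶ E ⊗ F} {d : A ⟶ A₁ ⊗ A₂}
    {c' : B ⟶ Y₁ ⊗ Y₂} {m₁ : A₁ ⊗ Y₁ ⟶ E} {m₂ : A₂ ⊗ Y₂ ⟶ F} :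
    a ≫ c = d ▷ B ≫ (A₁ ⊗ A₂) ◁ c' ≫ tensorμ A₁ A₂ Y₁ Y₂ ≫ (m₁ ⊗ₘ m₂) ↔
      ∀ Z, mulAt a Z ≫ comulAt c Z = A ◁ comulAt c' Z ≫ comulAt d (Y₁ ⊗ (Y₂ ⊗ Z)) ≫
        A₁ ◁ braidAt A₂ Y₁ (Y₂ ⊗ Z) ≫ mulAt m₁ (A₂ ⊗ (Y₂ ⊗ Z)) ≫ E ◁ mulAt m₂ Z := by
  rw [← whisker_exchange_assoc, diagL_iff]

end Tails

/-! ### The Hopf algebra, Hopf bimodules and the projection to the invariants -/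

section HopfTails

variable {C : Type u} [Category.{v} C] [MonoidalCategory C] [BraidedCategory C]
variable (H : C) [HopfObj H]

theorem mul_assoc_at (Z : C) :
    mulAt μ[H] (H ⊗ Z) ≫ mulAt μ[H] Z = H ◁ mulAt μ[H] Z ≫ mulAt μ[H] Z :=
  ((assoc_iff.1 (by simp)) Z).symm

theorem one_mul_at (Z : C) : oneAt η[H] (H ⊗ Z) ≫ mulAt μ[H] Z = 𝟙 _ :=
  one_mul_iff.1 (by simp) Z

theorem one_mul_at_assoc : type_of% (reassoc_of% @one_mul_at) :=
  @(reassoc_of% @one_mul_at)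

theorem mul_one_at (Z : C) : H ◁ oneAt η[H] Z ≫ mulAt μ[H] Z = 𝟙 _ :=
  mul_one_iff.1 (by simp) Z

theorem mul_one_at_assoc : type_of% (reassoc_of% @mul_one_at) :=
  @(reassoc_of% @mul_one_at)

theorem comul_assoc_at (Z : C) :
    comulAt Δ[H] Z ≫ comulAt Δ[H] (H ⊗ Z) = comulAt Δ[H] Z ≫ H ◁ comulAt Δ[H] Z :=
  ((coassoc_iff.1 (by simp)) Z).symm

theorem comul_assoc_at_assoc : type_of% (reassoc_of% @comul_assoc_at) :=
  @(reassoc_of% @comul_assoc_at)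

theorem counit_comul_at (Z : C) : comulAt Δ[H] Z ≫ counitAt ε[H] (H ⊗ Z) = 𝟙 _ :=
  counit_comul_iff.1 (by simp) Z

theorem counit_comul_at_assoc : type_of% (reassoc_of% @counit_comul_at) :=
  @(reassoc_of% @counit_comul_at)

theorem comul_counit_at (Z : C) : comulAt Δ[H] Z ≫ H ◁ counitAt ε[H] Z = 𝟙 _ :=
  comul_counit_iff.1 (by simp) Z

theorem comul_counit_at_assoc : type_of% (reassoc_of% @comul_counit_at) :=
  @(reassoc_of% @comul_counit_at)

theorem mul_comul_at (Z : C) : mulAt μ[H] Z ≫ comulAt Δ[H] Z =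
    H ◁ comulAt Δ[H] Z ≫ comulAt Δ[H] (H ⊗ (H ⊗ Z)) ≫
        H ◁ braidAt H H (H ⊗ Z) ≫ mulAt μ[H] (H ⊗ (H ⊗ Z)) ≫ H ◁ mulAt μ[H] Z :=
  diagR_iff.1 (by rw [BimonObj.mul_comul, MonoidalCategory.tensorHom_def, Category.assoc]) Z

theorem one_comul_at (Z : C) :
    oneAt η[H] Z ≫ comulAt Δ[H] Z = oneAt η[H] Z ≫ oneAt η[H] (H ⊗ Z) := by
  calc oneAt η[H] Z ≫ comulAt Δ[H] Z
      = (λ_ Z).inv ≫ (η[H] ≫ Δ[H]) ▷ Z ≫ (α_ _ _ _).hom := by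
        simp only [oneAt, comulAt, comp_whiskerRight, Category.assoc]
    _ = _ := by
      rw [BimonObj.one_comul, MonObj.tensorObj.one_def, MonoidalCategory.tensorHom_def']
      simp only [oneAt]
      monoidal

theorem mul_counit_at (Z : C) :
    mulAt μ[H] Z ≫ counitAt ε[H] Z = counitAt ε[H] (H ⊗ Z) ≫ counitAt ε[H] Z := by
  calc mulAt μ[H] Z ≫ counitAt ε[H] Z
      = (α_ _ _ _).inv ≫ (μ[H] ≫ ε[H]) ▷ Z ≫ (λ_ Z).hom := by
        simp only [mulAt, counitAt, comp_whiskerRight, Category.assoc]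
    _ = _ := by
      rw [Bimon.mul_counit, MonoidalCategory.tensorHom_def]
      simp only [counitAt]
      monoidal

theorem antipode_left_at (Z : C) :
    comulAt Δ[H] Z ≫ 𝒮[H] ▷ (H ⊗ Z) ≫ mulAt μ[H] Z = counitAt ε[H] Z ≫ oneAt η[H] Z := by
  have := congr($(HopfObj.antipode_left H) ▷ Z)
  simpa [comulAt, mulAt, oneAt, counitAt, -HopfObj.antipode_left] using this

theorem antipode_left_at_assoc : type_of% (reassoc_of% @antipode_left_at) :=
  @(reassoc_of% @antipode_left_at)

theorem antipode_right_at (Z : C) :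
    comulAt Δ[H] Z ≫ H ◁ 𝒮[H] ▷ Z ≫ mulAt μ[H] Z = counitAt ε[H] Z ≫ oneAt η[H] Z := by
  have := congr($(HopfObj.antipode_right H) ▷ Z)
  simpa [comulAt, mulAt, oneAt, counitAt, -HopfObj.antipode_right] using this

theorem antipode_right_at_assoc : type_of% (reassoc_of% @antipode_right_at) :=
  @(reassoc_of% @antipode_right_at)

theorem antipode_counit_at (Z : C) : 𝒮[H] ▷ Z ≫ counitAt ε[H] Z = counitAt ε[H] Z := by
  simp [counitAt, ← comp_whiskerRight_assoc]

theorem antipode_counit_at_assoc : type_of% (reassoc_of% @antipode_counit_at) :=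
  @(reassoc_of% @antipode_counit_at)

theorem one_antipode_at (Z : C) : oneAt η[H] Z ≫ 𝒮[H] ▷ Z = oneAt η[H] Z := by
  simp [oneAt, ← comp_whiskerRight]

theorem one_antipode_at_assoc : type_of% (reassoc_of% @one_antipode_at) :=
  @(reassoc_of% @one_antipode_at)

theorem mul_antipode_at (Z : C) :
    mulAt μ[H] Z ≫ 𝒮[H] ▷ Z =
      H ◁ 𝒮[H] ▷ Z ≫ 𝒮[H] ▷ (H ⊗ Z) ≫ braidAt H H Z ≫ mulAt μ[H] Z := by
  have := congr((α_ _ _ _).inv ≫ $(HopfObj.mul_antipode H) ▷ Z)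
  rw [MonoidalCategory.tensorHom_def'] at this
  simpa [mulAt, braidAt, -BraidedCategory.braiding_naturality_right,
    -BraidedCategory.braiding_naturality_right_assoc, -BraidedCategory.braiding_naturality_left,
    -BraidedCategory.braiding_naturality_left_assoc] using this

theorem mul_antipode_at_assoc : type_of% (reassoc_of% @mul_antipode_at) :=
  @(reassoc_of% @mul_antipode_at)

theorem antipode_comul_at (Z : C) :
    𝒮[H] ▷ Z ≫ comulAt Δ[H] Z =
      comulAt Δ[H] Z ≫ braidAt H H Z ≫ H ◁ 𝒮[H] ▷ Z ≫ 𝒮[H] ▷ (H ⊗ Z) := by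
  have := congr($(HopfObj.antipode_comul H) ▷ Z ≫ (α_ _ _ _).hom)
  rw [MonoidalCategory.tensorHom_def'] at this
  simpa [comulAt, braidAt] using this

theorem antipode_comul_at_assoc : type_of% (reassoc_of% @antipode_comul_at) :=
  @(reassoc_of% @antipode_comul_at)

end HopfTails

namespace HopfBimodule

variable {C : Type u} [Category.{v} C] [MonoidalCategory C] [BraidedCategory C]
variable {H : C} [HopfObj H] (X : HopfBimodule H)

theorem one_actL_at (Z : C) : oneAt η[H] (X.pt ⊗ Z) ≫ mulAt X.actL Z = 𝟙 _ :=
  one_mul_iff.1 X.isHopfBimodule.one_actL Z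

theorem one_actL_at_assoc : type_of% (reassoc_of% @one_actL_at) :=
  @(reassoc_of% @one_actL_at)

theorem mul_actL_at (Z : C) :
    mulAt μ[H] (X.pt ⊗ Z) ≫ mulAt X.actL Z = H ◁ mulAt X.actL Z ≫ mulAt X.actL Z :=
  (assoc_iff.1 (by rw [X.isHopfBimodule.mul_actL, Iso.inv_hom_id_assoc]) Z).symm

theorem mul_actL_at_assoc : type_of% (reassoc_of% @mul_actL_at) :=
  @(reassoc_of% @mul_actL_at)

theorem actR_one_at (Z : C) : X.pt ◁ oneAt η[H] Z ≫ mulAt X.actR Z = 𝟙 _ :=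
  mul_one_iff.1 X.isHopfBimodule.actR_one Z

theorem actR_one_at_assoc : type_of% (reassoc_of% @actR_one_at) :=
  @(reassoc_of% @actR_one_at)

theorem actR_mul_at (Z : C) :
    X.pt ◁ mulAt μ[H] Z ≫ mulAt X.actR Z = mulAt X.actR (H ⊗ Z) ≫ mulAt X.actR Z :=
  assoc_iff.1 X.isHopfBimodule.actR_mul Z

theorem actR_mul_at_assoc : type_of% (reassoc_of% @actR_mul_at) :=
  @(reassoc_of% @actR_mul_at)

theorem actL_actR_at (Z : C) :
    mulAt X.actL (H ⊗ Z) ≫ mulAt X.actR Z = H ◁ mulAt X.actR Z ≫ mulAt X.actL Z :=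
  (assoc_iff.1 (by rw [X.isHopfBimodule.actL_actR, Iso.inv_hom_id_assoc]) Z).symm

theorem actL_actR_at_assoc : type_of% (reassoc_of% @actL_actR_at) :=
  @(reassoc_of% @actL_actR_at)

theorem coactL_counit_at (Z : C) : comulAt X.coactL Z ≫ counitAt ε[H] (X.pt ⊗ Z) = 𝟙 _ :=
  counit_comul_iff.1 X.isHopfBimodule.coactL_counit Z

theorem coactL_counit_at_assoc : type_of% (reassoc_of% @coactL_counit_at) :=
  @(reassoc_of% @coactL_counit_at)

theorem coactL_comul_at (Z : C) :
    comulAt X.coactL Z ≫ H ◁ comulAt X.coactL Z =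
      comulAt X.coactL Z ≫ comulAt Δ[H] (X.pt ⊗ Z) :=
  coassoc_iff.1 (by simp [reassoc_of% X.isHopfBimodule.coactL_comul]) Z

theorem coactL_comul_at_assoc : type_of% (reassoc_of% @coactL_comul_at) :=
  @(reassoc_of% @coactL_comul_at)

theorem coactR_counit_at (Z : C) : comulAt X.coactR Z ≫ X.pt ◁ counitAt ε[H] Z = 𝟙 _ :=
  comul_counit_iff.1 X.isHopfBimodule.coactR_counit Z

theorem coactR_counit_at_assoc : type_of% (reassoc_of% @coactR_counit_at) :=
  @(reassoc_of% @coactR_counit_at)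

theorem coactR_comul_at (Z : C) :
    comulAt X.coactR Z ≫ X.pt ◁ comulAt Δ[H] Z =
      comulAt X.coactR Z ≫ comulAt X.coactR (H ⊗ Z) :=
  coassoc_iff.1 X.isHopfBimodule.coactR_comul Z

theorem coactR_comul_at_assoc : type_of% (reassoc_of% @coactR_comul_at) :=
  @(reassoc_of% @coactR_comul_at)

theorem coactL_coactR_at (Z : C) :
    comulAt X.coactR Z ≫ comulAt X.coactL (H ⊗ Z) =
      comulAt X.coactL Z ≫ H ◁ comulAt X.coactR Z :=
  (coassoc_iff.1 (by simp [reassoc_of% X.isHopfBimodule.coactL_coactR]) Z).symm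

theorem coactL_coactR_at_assoc : type_of% (reassoc_of% @coactL_coactR_at) :=
  @(reassoc_of% @coactL_coactR_at)

theorem actL_coactL_at (Z : C) : mulAt X.actL Z ≫ comulAt X.coactL Z =
    H ◁ comulAt X.coactL Z ≫ comulAt Δ[H] (H ⊗ (X.pt ⊗ Z)) ≫
      H ◁ braidAt H H (X.pt ⊗ Z) ≫ mulAt μ[H] (H ⊗ (X.pt ⊗ Z)) ≫ H ◁ mulAt X.actL Z :=
  diagL_iff.1 X.isHopfBimodule.actL_coactL Z

theorem actL_coactL_at_assoc : type_of% (reassoc_of% @actL_coactL_at) :=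
  @(reassoc_of% @actL_coactL_at)

theorem actR_coactL_at (Z : C) : mulAt X.actR Z ≫ comulAt X.coactL Z =
    X.pt ◁ comulAt Δ[H] Z ≫ comulAt X.coactL (H ⊗ (H ⊗ Z)) ≫
      H ◁ braidAt X.pt H (H ⊗ Z) ≫ mulAt μ[H] (X.pt ⊗ (H ⊗ Z)) ≫ H ◁ mulAt X.actR Z :=
  diagR_iff.1 X.isHopfBimodule.actR_coactL Z

theorem actR_coactL_at_assoc : type_of% (reassoc_of% @actR_coactL_at) :=
  @(reassoc_of% @actR_coactL_at)

theorem actL_coactR_at (Z : C) : mulAt X.actL Z ≫ comulAt X.coactR Z =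
    H ◁ comulAt X.coactR Z ≫ comulAt Δ[H] (X.pt ⊗ (H ⊗ Z)) ≫
      H ◁ braidAt H X.pt (H ⊗ Z) ≫ mulAt X.actL (H ⊗ (H ⊗ Z)) ≫ X.pt ◁ mulAt μ[H] Z :=
  diagL_iff.1 X.isHopfBimodule.actL_coactR Z

theorem actL_coactR_at_assoc : type_of% (reassoc_of% @actL_coactR_at) :=
  @(reassoc_of% @actL_coactR_at)

theorem actR_coactR_at (Z : C) : mulAt X.actR Z ≫ comulAt X.coactR Z =
    X.pt ◁ comulAt Δ[H] Z ≫ comulAt X.coactR (H ⊗ (H ⊗ Z)) ≫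
      X.pt ◁ braidAt H H (H ⊗ Z) ≫ mulAt X.actR (H ⊗ (H ⊗ Z)) ≫ X.pt ◁ mulAt μ[H] Z :=
  diagR_iff.1 X.isHopfBimodule.actR_coactR Z

theorem actR_coactR_at_assoc : type_of% (reassoc_of% @actR_coactR_at) :=
  @(reassoc_of% @actR_coactR_at)

/-- `Π(x) = S(x₋₁) x₀`. -/
theorem proj_at (Z : C) :
    X.proj ▷ Z = comulAt X.coactL Z ≫ 𝒮[H] ▷ (X.pt ⊗ Z) ≫ mulAt X.actL Z := by
  simp [proj, comulAt, mulAt]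

/-- `x = x₋₁ Π(x₀)`: a Hopf bimodule is generated by its invariants as a left module. -/
theorem coactL_proj_actL_at (Z : C) :
    comulAt X.coactL Z ≫ H ◁ X.proj ▷ Z ≫ mulAt X.actL Z = 𝟙 _ := by
  simp only [proj_at, whiskerLeft_comp, Category.assoc]
  rw [← X.mul_actL_at, X.coactL_comul_at_assoc, antipode_right_at_assoc, X.one_actL_at]
  simp [X.coactL_counit_at]

/-- `Π(h x) = ε(h) Π(x)`. -/
theorem actL_proj_at (Z : C) :
    mulAt X.actL Z ≫ X.proj ▷ Z = counitAt ε[H] (X.pt ⊗ Z) ≫ X.proj ▷ Z := by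
  rw [proj_at, X.actL_coactL_at_assoc]
  rw [whisker_exchange_assoc, mul_antipode_at_assoc, mulAt_nat_assoc, X.mul_actL_at,
    whiskerRight_braidAt_assoc, whiskerLeft_whiskerRight_braidAt_assoc]
  simp only [← whisker_exchange_assoc, ← braidAt_whiskerLeft_comulAt_assoc]
  simp only [← whiskerLeft_comp_assoc, ← X.mul_actL_at, antipode_left_at_assoc, X.one_actL_at,
    Category.comp_id]
  rw [braidAt_whiskerLeft_counitAt_assoc]
  simp only [← counitAt_nat_assoc]

theorem actL_proj_at_assoc : type_of% (reassoc_of% @actL_proj_at) :=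
  @(reassoc_of% @actL_proj_at)

theorem proj_proj : X.proj ≫ X.proj = X.proj := by
  apply eq_of_whiskerRight_unit
  rw [comp_whiskerRight]
  nth_rw 1 [proj_at]
  simp only [Category.assoc, actL_proj_at, antipode_counit_at_assoc, X.coactL_counit_at_assoc]

/-- The left coaction is trivial on the image of `Π`. -/
theorem proj_coactL_at (Z : C) :
    X.proj ▷ Z ≫ comulAt X.coactL Z = X.proj ▷ Z ≫ oneAt η[H] (X.pt ⊗ Z) := by
  rw [proj_at]
  simp only [Category.assoc, X.actL_coactL_at]
  rw [← whisker_exchange_assoc, X.coactL_comul_at_assoc, antipode_comul_at_assoc,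
    comul_assoc_at_assoc, whisker_exchange_assoc, ← whiskerLeft_whiskerRight_braidAt_assoc]
  simp only [← whiskerLeft_comp_assoc, whiskerRight_braidAt]
  simp only [whiskerLeft_comp_assoc, ← mulAt_nat_assoc, ← whiskerLeft_mulAt_braidAt_assoc]
  simp only [← whiskerLeft_comp_assoc, antipode_left_at]
  simp only [whiskerLeft_comp, Category.assoc, whiskerLeft_oneAt_braidAt_assoc,
    comul_counit_at_assoc, oneAt_nat_assoc, oneAt_nat]

/-- `Π(Π(x) h) = Π(x h)`. -/
theorem proj_actR_proj_at (Z : C) :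
    X.proj ▷ (H ⊗ Z) ≫ mulAt X.actR Z ≫ X.proj ▷ Z = mulAt X.actR Z ≫ X.proj ▷ Z := by
  symm
  have h := X.coactL_proj_actL_at (H ⊗ Z)
  calc _ = (comulAt X.coactL (H ⊗ Z) ≫ H ◁ X.proj ▷ (H ⊗ Z) ≫ mulAt X.actL (H ⊗ Z)) ≫
        mulAt X.actR Z ≫ X.proj ▷ Z := by rw [h, Category.id_comp]
    _ = _ := by
      simp only [Category.assoc, X.actL_actR_at_assoc, X.actL_proj_at]
      simp only [← counitAt_nat_assoc]
      rw [X.coactL_counit_at_assoc]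

theorem proj_actR_proj_at_assoc : type_of% (reassoc_of% @proj_actR_proj_at) :=
  @(reassoc_of% @proj_actR_proj_at)

end HopfBimodule

/-! ### The invariants of a Hopf bimodule form a crossed module -/

section Crossed

variable {C : Type u} [Category.{v} C] [MonoidalCategory C] [BraidedCategory C]

/-- `V` is a right crossed module (Yetter-Drinfeld module) over `H`: a right module by `a` and a
right comodule by `c`, such that, up to braidings, `(v₀ ◁ h₁) ⊗ v₁ h₂ = (v ◁ h₂)₀ ⊗ h₁ (v ◁ h₂)₁`.
All axioms are stated with a further object `Z` on the right. -/
structure IsCrossed {H : C} [HopfObj H] {V : C} (a : V ⊗ H ⟶ V) (c : V ⟶ V ⊗ H) : Prop where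
  act_one (Z : C) : V ◁ oneAt η[H] Z ≫ mulAt a Z = 𝟙 _
  act_mul (Z : C) : V ◁ mulAt μ[H] Z ≫ mulAt a Z = mulAt a (H ⊗ Z) ≫ mulAt a Z
  coact_counit (Z : C) : comulAt c Z ≫ V ◁ counitAt ε[H] Z = 𝟙 _
  coact_comul (Z : C) : comulAt c Z ≫ V ◁ comulAt Δ[H] Z = comulAt c Z ≫ comulAt c (H ⊗ Z)
  crossed (Z : C) :
    V ◁ comulAt Δ[H] Z ≫ comulAt c (H ⊗ (H ⊗ Z)) ≫ V ◁ braidAt H H (H ⊗ Z) ≫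
        mulAt a (H ⊗ (H ⊗ Z)) ≫ V ◁ mulAt μ[H] Z =
      V ◁ comulAt Δ[H] Z ≫ braidAt V H (H ⊗ Z) ≫ H ◁ (mulAt a Z ≫ comulAt c Z) ≫
        braidAt H V (H ⊗ Z) ≫ V ◁ mulAt μ[H] Z

end Crossed

namespace InvariantSplitting

variable {C : Type u} [Category.{v} C] [MonoidalCategory C] [BraidedCategory C]
variable {H : C} [HopfObj H] {X : HopfBimodule H} (s : InvariantSplitting X)

theorem p_i_at (Z : C) : s.p ▷ Z ≫ s.i ▷ Z = X.proj ▷ Z := by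
  rw [← comp_whiskerRight, s.p_i]

theorem p_i_at_assoc : type_of% (reassoc_of% @p_i_at) :=
  @(reassoc_of% @p_i_at)

theorem i_p_at (Z : C) : s.i ▷ Z ≫ s.p ▷ Z = 𝟙 _ := by
  rw [← comp_whiskerRight, s.i_p, id_whiskerRight]

theorem i_p_at_assoc : type_of% (reassoc_of% @i_p_at) :=
  @(reassoc_of% @i_p_at)

theorem proj_p_at (Z : C) : X.proj ▷ Z ≫ s.p ▷ Z = s.p ▷ Z := by
  rw [← s.p_i_at, Category.assoc, s.i_p_at, Category.comp_id]

theorem i_proj_at (Z : C) : s.i ▷ Z ≫ X.proj ▷ Z = s.i ▷ Z := by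
  rw [← s.p_i_at, s.i_p_at_assoc]

theorem i_proj_at_assoc : type_of% (reassoc_of% @i_proj_at) :=
  @(reassoc_of% @i_proj_at)

theorem act_at (Z : C) : mulAt s.act Z = s.i ▷ (H ⊗ Z) ≫ mulAt X.actR Z ≫ s.p ▷ Z := by
  simp [act, mulAt]

theorem act_at_assoc : type_of% (reassoc_of% @act_at) :=
  @(reassoc_of% @act_at)

theorem coact_at (Z : C) : comulAt s.coact Z = s.i ▷ Z ≫ comulAt X.coactR Z ≫ s.p ▷ (H ⊗ Z) := by
  simp [coact, comulAt]

theorem i_coactL_at (Z : C) :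
    s.i ▷ Z ≫ comulAt X.coactL Z = s.i ▷ Z ≫ oneAt η[H] (X.pt ⊗ Z) := by
  rw [← s.i_proj_at, Category.assoc, Category.assoc, X.proj_coactL_at]

theorem i_coactL_at_assoc : type_of% (reassoc_of% @i_coactL_at) :=
  @(reassoc_of% @i_coactL_at)

theorem actL_p_at (Z : C) :
    mulAt X.actL Z ≫ s.p ▷ Z = counitAt ε[H] (X.pt ⊗ Z) ≫ s.p ▷ Z := by
  rw [← s.proj_p_at, X.actL_proj_at_assoc]

theorem actL_p_at_assoc : type_of% (reassoc_of% @actL_p_at) :=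
  @(reassoc_of% @actL_p_at)

/-- The projection to the invariants is a morphism of right modules, even if `Π` is not one. -/
theorem p_act_at (Z : C) : s.p ▷ (H ⊗ Z) ≫ mulAt s.act Z = mulAt X.actR Z ≫ s.p ▷ Z := by
  rw [act_at, s.p_i_at_assoc, ← s.proj_p_at, X.proj_actR_proj_at_assoc]

/-- The inclusion of the invariants is a morphism of right comodules. -/
theorem i_coactR_at (Z : C) :
    s.i ▷ Z ≫ comulAt X.coactR Z = comulAt s.coact Z ≫ s.i ▷ (H ⊗ Z) := by
  simp only [coact_at, Category.assoc, s.p_i_at, X.proj_at]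
  rw [X.coactL_coactR_at_assoc, s.i_coactL_at_assoc, oneAt_nat_assoc, one_antipode_at_assoc,
    X.one_actL_at, Category.comp_id]

theorem i_coactR_at_assoc : type_of% (reassoc_of% @i_coactR_at) :=
  @(reassoc_of% @i_coactR_at)

/-- For an invariant `v` one has `v h = h₁ (v ◁ h₂)`, up to the braiding of `v` with `h₁`. -/
theorem i_actR_at (Z : C) :
    s.i ▷ (H ⊗ Z) ≫ mulAt X.actR Z = s.inv ◁ comulAt Δ[H] Z ≫ braidAt s.inv H (H ⊗ Z) ≫
      H ◁ mulAt s.act Z ≫ H ◁ s.i ▷ Z ≫ mulAt X.actL Z := by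
  have h := X.coactL_proj_actL_at Z
  calc _ = s.i ▷ (H ⊗ Z) ≫ mulAt X.actR Z ≫
        comulAt X.coactL Z ≫ H ◁ X.proj ▷ Z ≫ mulAt X.actL Z := by rw [h, Category.comp_id]
    _ = _ := by
      simp only [X.actR_coactL_at_assoc, act_at, whiskerLeft_comp, Category.assoc]
      rw [← whisker_exchange_assoc, i_coactL_at_assoc, oneAt_nat_assoc, one_mul_at_assoc,
        whiskerRight_braidAt_assoc]
      simp only [← whiskerLeft_comp_assoc, s.p_i_at]

/-- The invariants of a Hopf bimodule form a crossed module. -/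
theorem isCrossed : IsCrossed s.act s.coact where
  act_one Z := by
    rw [act_at, whisker_exchange_assoc, X.actR_one_at_assoc, s.i_p_at]
  act_mul Z := by
    nth_rw 2 [act_at]
    simp only [Category.assoc, s.p_act_at]
    rw [act_at, whisker_exchange_assoc, X.actR_mul_at_assoc]
  coact_counit Z := by
    rw [coact_at, Category.assoc, Category.assoc, ← whisker_exchange, X.coactR_counit_at_assoc,
      s.i_p_at]
  coact_comul Z := by
    nth_rw 1 [coact_at]
    rw [Category.assoc, Category.assoc, ← whisker_exchange, X.coactR_comul_at_assoc,
      s.i_coactR_at_assoc, coact_at s (H ⊗ Z)]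
  crossed Z := by
    -- Apply the right coaction of `X` to `v h = h₁ (v ◁ h₂)` and project to the invariants.
    have h := congr($(s.i_actR_at Z) ≫ comulAt X.coactR Z ≫ s.p ▷ (H ⊗ Z))
    simp only [Category.assoc, X.actR_coactR_at_assoc, X.actL_coactR_at_assoc] at h
    simp only [← whisker_exchange_assoc, i_coactR_at_assoc, whisker_exchange, s.actL_p_at_assoc,
      ← act_at_assoc] at h
    simp only [← counitAt_nat_assoc, counit_comul_at_assoc,
      ← whiskerLeft_whiskerRight_braidAt_assoc] at h
    simpa only [coact_at s Z, whiskerLeft_comp, Category.assoc] using h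

end InvariantSplitting

/-! ### The Hopf bimodule `X ⊗ V` of a crossed module `V` -/

section Tensor

variable {C : Type u} [Category.{v} C] [MonoidalCategory C] [BraidedCategory C]

/-- The axioms of a Hopf bimodule may be verified with a further object on the right. -/
theorem HopfBimodData.IsHopfBimodule.of_at {H : C} [HopfObj H] {X : HopfBimodData H}
    (one_actL : ∀ Z, oneAt η[H] (X.pt ⊗ Z) ≫ mulAt X.actL Z = 𝟙 _)
    (mul_actL : ∀ Z, mulAt μ[H] (X.pt ⊗ Z) ≫ mulAt X.actL Z =
      H ◁ mulAt X.actL Z ≫ mulAt X.actL Z)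
    (actR_one : ∀ Z, X.pt ◁ oneAt η[H] Z ≫ mulAt X.actR Z = 𝟙 _)
    (actR_mul : ∀ Z, X.pt ◁ mulAt μ[H] Z ≫ mulAt X.actR Z =
      mulAt X.actR (H ⊗ Z) ≫ mulAt X.actR Z)
    (actL_actR : ∀ Z, mulAt X.actL (H ⊗ Z) ≫ mulAt X.actR Z =
      H ◁ mulAt X.actR Z ≫ mulAt X.actL Z)
    (coactL_counit : ∀ Z, comulAt X.coactL Z ≫ counitAt ε[H] (X.pt ⊗ Z) = 𝟙 _)
    (coactL_comul : ∀ Z, comulAt X.coactL Z ≫ H ◁ comulAt X.coactL Z =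
      comulAt X.coactL Z ≫ comulAt Δ[H] (X.pt ⊗ Z))
    (coactR_counit : ∀ Z, comulAt X.coactR Z ≫ X.pt ◁ counitAt ε[H] Z = 𝟙 _)
    (coactR_comul : ∀ Z, comulAt X.coactR Z ≫ X.pt ◁ comulAt Δ[H] Z =
      comulAt X.coactR Z ≫ comulAt X.coactR (H ⊗ Z))
    (coactL_coactR : ∀ Z, comulAt X.coactR Z ≫ comulAt X.coactL (H ⊗ Z) =
      comulAt X.coactL Z ≫ H ◁ comulAt X.coactR Z)
    (actL_coactL : ∀ Z, mulAt X.actL Z ≫ comulAt X.coactL Z =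
      H ◁ comulAt X.coactL Z ≫ comulAt Δ[H] (H ⊗ (X.pt ⊗ Z)) ≫
        H ◁ braidAt H H (X.pt ⊗ Z) ≫ mulAt μ[H] (H ⊗ (X.pt ⊗ Z)) ≫ H ◁ mulAt X.actL Z)
    (actR_coactL : ∀ Z, mulAt X.actR Z ≫ comulAt X.coactL Z =
      X.pt ◁ comulAt Δ[H] Z ≫ comulAt X.coactL (H ⊗ (H ⊗ Z)) ≫
        H ◁ braidAt X.pt H (H ⊗ Z) ≫ mulAt μ[H] (X.pt ⊗ (H ⊗ Z)) ≫ H ◁ mulAt X.actR Z)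
    (actL_coactR : ∀ Z, mulAt X.actL Z ≫ comulAt X.coactR Z =
      H ◁ comulAt X.coactR Z ≫ comulAt Δ[H] (X.pt ⊗ (H ⊗ Z)) ≫
        H ◁ braidAt H X.pt (H ⊗ Z) ≫ mulAt X.actL (H ⊗ (H ⊗ Z)) ≫ X.pt ◁ mulAt μ[H] Z)
    (actR_coactR : ∀ Z, mulAt X.actR Z ≫ comulAt X.coactR Z =
      X.pt ◁ comulAt Δ[H] Z ≫ comulAt X.coactR (H ⊗ (H ⊗ Z)) ≫
        X.pt ◁ braidAt H H (H ⊗ Z) ≫ mulAt X.actR (H ⊗ (H ⊗ Z)) ≫ X.pt ◁ mulAt μ[H] Z) :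
    X.IsHopfBimodule where
  one_actL := one_mul_iff.2 one_actL
  mul_actL := by
    rw [assoc_iff.2 fun Z => (mul_actL Z).symm, Iso.hom_inv_id_assoc]
  actR_one := mul_one_iff.2 actR_one
  actR_mul := assoc_iff.2 actR_mul
  actL_actR := by
    rw [assoc_iff.2 fun Z => (actL_actR Z).symm, Iso.hom_inv_id_assoc]
  coactL_counit := counit_comul_iff.2 coactL_counit
  coactL_comul := by
    simp [reassoc_of% coassoc_iff.2 coactL_comul]
  coactR_counit := comul_counit_iff.2 coactR_counit
  coactR_comul := coassoc_iff.2 coactR_comul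
  coactL_coactR := by
    simp [reassoc_of% coassoc_iff.2 fun Z => (coactL_coactR Z).symm]
  actL_coactL := diagL_iff.2 actL_coactL
  actR_coactL := diagR_iff.2 actR_coactL
  actL_coactR := diagL_iff.2 actL_coactR
  actR_coactR := diagR_iff.2 actR_coactR

theorem diagActR_at {H : C} [HopfObj H] {X Y : C} (a : X ⊗ H ⟶ X) (b : Y ⊗ H ⟶ Y) (Z : C) :
    mulAt (diagActR a b) Z = (α_ _ _ _).hom ≫ X ◁ Y ◁ comulAt Δ[H] Z ≫
      X ◁ braidAt Y H (H ⊗ Z) ≫ mulAt a (Y ⊗ (H ⊗ Z)) ≫ X ◁ mulAt b Z ≫ (α_ _ _ _).inv := by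
  simp only [diagActR, mulAt, comulAt, braidAt, tensorμ, MonoidalCategory.tensorHom_def]
  monoidal

theorem diagCoactR_at {H : C} [HopfObj H] {X Y : C} (a : X ⟶ X ⊗ H) (b : Y ⟶ Y ⊗ H) (Z : C) :
    comulAt (diagCoactR a b) Z = (α_ _ _ _).hom ≫ X ◁ comulAt b Z ≫ comulAt a (Y ⊗ (H ⊗ Z)) ≫
      X ◁ braidAt H Y (H ⊗ Z) ≫ X ◁ Y ◁ mulAt μ[H] Z ≫ (α_ _ _ _).inv := by
  simp only [diagCoactR, mulAt, comulAt, braidAt, tensorμ, MonoidalCategory.tensorHom_def']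
  monoidal

/-- The tensor product of a Hopf bimodule and a crossed module is a Hopf bimodule. The crossed
module law is needed only for the compatibility of the two diagonal structures, `actR_coactR`. -/
theorem isHopfBimodule_tensor {H : C} [HopfObj H] (X : HopfBimodule H) {V : C}
    {a : V ⊗ H ⟶ V} {c : V ⟶ V ⊗ H} (h : IsCrossed a c) :
    HopfBimodData.IsHopfBimodule (H := H) {
      pt := X.pt ⊗ V
      actL := (α_ H X.pt V).inv ≫ X.actL ▷ V
      actR := diagActR X.actR a
      coactL := X.coactL ▷ V ≫ (α_ H X.pt V).hom
      coactR := diagCoactR X.coactR c } := by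
  apply HopfBimodData.IsHopfBimodule.of_at <;> intro Z <;>
    simp only [diagActR_at, diagCoactR_at, whiskerRight_actL_at, whiskerRight_coactL_at,
      braidAt_tensor_left, braidAt_tensor_right, tensor_whiskerLeft, Category.assoc,
      Iso.inv_hom_id_assoc, whiskerLeft_comp, whiskerLeft_inv_hom_assoc]
  case one_actL =>
    simp [oneAt_nat_assoc, X.one_actL_at_assoc]
  case mul_actL =>
    rw [mulAt_nat_assoc, X.mul_actL_at_assoc]
  case actR_one =>
    simp only [← whiskerLeft_comp_assoc, one_comul_at]
    simp only [whiskerLeft_comp, Category.assoc]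
    simp only [← whiskerLeft_comp_assoc X.pt, whiskerLeft_oneAt_braidAt]
    simp only [whiskerLeft_comp, Category.assoc, X.actR_one_at_assoc]
    simp [← whiskerLeft_comp_assoc, h.act_one]
  case actR_mul =>
    simp only [← whiskerLeft_comp_assoc, mul_comul_at, ← comulAt_nat_assoc]
    simp only [whiskerLeft_comp, Category.assoc]
    simp only [← whiskerLeft_comp_assoc X.pt, mulAt_nat_assoc a, mulAt_braidAt,
      whiskerLeft_mulAt_braidAt_assoc, ← braidAt_nat, ← braidAt_nat_assoc]
    simp only [whiskerLeft_comp, Category.assoc, X.actR_mul_at_assoc, ← mulAt_nat_assoc X.actR]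
    simp only [← whiskerLeft_comp_assoc X.pt, h.act_mul]
  case actL_actR =>
    rw [mulAt_nat_assoc, mulAt_nat_assoc, X.actL_actR_at_assoc]
    simp only [mulAt_nat_assoc X.actL]
  case coactL_counit =>
    simp only [← counitAt_nat, X.coactL_counit_at_assoc, Iso.hom_inv_id]
  case coactL_comul =>
    rw [← comulAt_nat, X.coactL_comul_at_assoc]
  case coactR_counit =>
    simp only [← whiskerLeft_comp, ← whiskerLeft_comp_assoc, mul_counit_at]
    simp only [whiskerLeft_comp, Category.assoc]
    simp only [← whiskerLeft_comp_assoc X.pt, braidAt_whiskerLeft_counitAt_assoc]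
    simp only [whiskerLeft_comp, Category.assoc, X.coactR_counit_at_assoc]
    simp [← whiskerLeft_comp_assoc, h.coact_counit]
  case coactR_comul =>
    simp only [← whiskerLeft_comp, ← whiskerLeft_comp_assoc, mul_comul_at, ← comulAt_nat,
      ← comulAt_nat_assoc]
    simp only [whiskerLeft_comp, Category.assoc, ← X.coactR_comul_at_assoc]
    simp only [← whiskerLeft_comp_assoc X.pt, ← whiskerLeft_comp_assoc H, braidAt_nat_assoc,
      braidAt_whiskerLeft_comulAt_assoc, braidAt_comulAt_assoc, ← h.coact_comul]
    simp only [whiskerLeft_comp, Category.assoc]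
    simp only [← whiskerLeft_comp_assoc X.pt, ← braidAt_nat_assoc, ← comulAt_nat_assoc]
    simp only [← whiskerLeft_comp V, ← mulAt_nat]
  case coactL_coactR =>
    simp only [← comulAt_nat_assoc, X.coactL_coactR_at_assoc]
  case actL_coactL =>
    simp only [X.actL_coactL_at_assoc, ← comulAt_nat_assoc]
    simp only [← whiskerLeft_comp_assoc H, ← whiskerLeft_comp H, ← braidAt_nat]
    simp only [whiskerLeft_comp, Category.assoc, ← mulAt_nat_assoc]
    simp only [← whiskerLeft_comp, ← whiskerLeft_comp_assoc, Iso.inv_hom_id, whiskerLeft_id,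
      Category.id_comp]
  case actR_coactL =>
    rw [← comulAt_nat_assoc, X.actR_coactL_at_assoc]
    simp only [← mulAt_nat_assoc]
    simp only [whiskerLeft_inv_hom_assoc]
    simp only [← whiskerLeft_comp_assoc X.pt, braidAt_comulAt]
    simp only [← whiskerLeft_comp_assoc V, comul_assoc_at]
    simp only [whiskerLeft_comp, Category.assoc]
    simp only [← whiskerLeft_comp_assoc X.pt, ← braidAt_nat_assoc]
    simp only [whiskerLeft_comp, Category.assoc, ← comulAt_nat_assoc]
    simp only [← whiskerLeft_comp_assoc H, ← whiskerLeft_comp H, ← braidAt_nat, ← braidAt_nat_assoc]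
    simp only [whiskerLeft_comp, Category.assoc, ← mulAt_nat_assoc]
  case actL_coactR =>
    rw [← comulAt_nat_assoc X.coactR, X.actL_coactR_at_assoc]
    simp only [← whiskerLeft_comp_assoc H, ← comulAt_nat_assoc]
    simp only [← whiskerLeft_comp, ← whiskerLeft_comp_assoc, Iso.inv_hom_id, Category.comp_id]
    simp only [whiskerLeft_comp, Category.assoc]
    simp only [← whiskerLeft_comp_assoc H, ← braidAt_nat_assoc]
    simp only [whiskerLeft_comp, Category.assoc, ← mulAt_nat_assoc]
    simp only [← whiskerLeft_comp_assoc X.pt, ← braidAt_nat_assoc, mulAt_nat_assoc μ[H]]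
    simp only [mulAt_braidAt_assoc, ← whiskerLeft_comp V, mul_assoc_at]
  case actR_coactR =>
    simp only [← comulAt_nat_assoc]
    simp only [X.actR_coactR_at_assoc]
    simp only [← whiskerLeft_comp_assoc X.pt, mulAt_nat_assoc μ[H], mulAt_braidAt_assoc]
    simp only [← whiskerLeft_comp_assoc V, ← whiskerLeft_comp V, mul_assoc_at]
    simp only [← whiskerLeft_comp_assoc V, braidAt_comulAt, comul_assoc_at]
    simp only [whiskerLeft_comp, Category.assoc]
    simp only [← whiskerLeft_comp_assoc X.pt, ← braidAt_nat, ← braidAt_nat_assoc]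
    simp only [whiskerLeft_comp, Category.assoc, ← comulAt_nat_assoc X.coactR]
    simp only [← whiskerLeft_comp_assoc X.pt, ← braidAt_nat, ← braidAt_nat_assoc]
    simp only [whiskerLeft_comp, Category.assoc, ← mulAt_nat_assoc X.actR]
    simp only [← whiskerLeft_comp_assoc X.pt, braidAt_nat_assoc]
    -- The crossed module law of `V` exchanges its action and its coaction.
    simp only [← whiskerLeft_comp_assoc H, ← h.crossed]
    simp only [whiskerLeft_comp, Category.assoc]
    simp only [← whiskerLeft_comp_assoc X.pt, ← whiskerLeft_comp_assoc V, mulAt_nat_assoc μ[H],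
      mulAt_braidAt]
    simp only [whiskerLeft_comp, Category.assoc]
    simp only [← whiskerLeft_comp_assoc X.pt, ← braidAt_nat, ← braidAt_nat_assoc]
    simp only [whiskerLeft_comp, Category.assoc, ← mulAt_nat_assoc X.actR]
    simp only [← whiskerLeft_comp_assoc X.pt, ← whiskerLeft_comp_assoc V, ← whiskerLeft_comp V,
      mulAt_braidAt, whiskerLeft_mulAt_braidAt_assoc]
    simp only [whiskerLeft_comp, Category.assoc]
    simp only [← whiskerLeft_comp_assoc X.pt, ← mulAt_nat_assoc a]
    simp only [← whiskerLeft_comp_assoc V, ← whiskerLeft_comp V, mul_assoc_at]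
    simp only [whiskerLeft_comp, Category.assoc]
    simp only [mulAt_nat_assoc X.actR]
    simp only [← whiskerLeft_comp_assoc X.pt, braidAt_nat_assoc]
    simp only [whiskerLeft_comp, Category.assoc]
    simp only [← whiskerLeft_comp_assoc X.pt, ← whiskerLeft_comp_assoc H (braidAt V H _),
      braidAt_nat]
    simp only [whiskerLeft_comp, Category.assoc]
    simp only [← whiskerLeft_comp_assoc X.pt, ← whiskerLeft_comp_assoc H (braidAt V H _),
      braidAt_whiskerLeft_comulAt]
    simp only [whiskerLeft_comp, Category.assoc]
    simp only [← whiskerLeft_comp_assoc X.pt, ← whiskerLeft_comp_assoc H (braidAt V H _),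
      braidAt_nat]
    simp only [whiskerLeft_comp, Category.assoc]
    -- The remaining braidings are reordered by the Yang-Baxter equation.
    simp only [← whiskerLeft_comp_assoc X.pt, yang_baxter_at_assoc]
    simp only [whiskerLeft_comp, Category.assoc]
    simp only [← whiskerLeft_comp_assoc X.pt, ← whiskerLeft_comp_assoc H, ← whiskerLeft_comp H,
      comulAt_nat_assoc c]
    simp only [← whiskerLeft_comp_assoc V, ← whiskerLeft_comp V, comul_assoc_at]
    simp only [whiskerLeft_comp, Category.assoc]
    simp only [← whiskerLeft_comp_assoc X.pt, ← braidAt_nat_assoc]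
    simp only [whiskerLeft_comp, Category.assoc]
    simp only [← whiskerLeft_comp_assoc X.pt, ← whiskerLeft_comp_assoc V, ← braidAt_nat]
    simp only [whiskerLeft_comp, Category.assoc]
    simp only [← whiskerLeft_comp_assoc X.pt, ← braidAt_nat_assoc]

end Tensor

/-! ### Morphisms of crossed modules -/

section CrossedHom

variable {C : Type u} [Category.{v} C] [MonoidalCategory C]

/-- A morphism compatible with right actions and right coactions of `H`. -/
structure IsCrossedHom {H V W : C} (a : V ⊗ H ⟶ V) (c : V ⟶ V ⊗ H) (a' : W ⊗ H ⟶ W)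
    (c' : W ⟶ W ⊗ H) (f : V ⟶ W) : Prop where
  act : a ≫ f = f ▷ H ≫ a'
  coact : f ≫ c' = c ≫ f ▷ H

namespace IsCrossedHom

variable {H V W U : C} {a : V ⊗ H ⟶ V} {c : V ⟶ V ⊗ H} {a' : W ⊗ H ⟶ W} {c' : W ⟶ W ⊗ H}
  {a'' : U ⊗ H ⟶ U} {c'' : U ⟶ U ⊗ H}

theorem id (a : V ⊗ H ⟶ V) (c : V ⟶ V ⊗ H) : IsCrossedHom a c a c (𝟙 V) :=
  ⟨by simp, by simp⟩

theorem comp {f : V ⟶ W} {g : W ⟶ U} (hf : IsCrossedHom a c a' c' f)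
    (hg : IsCrossedHom a' c' a'' c'' g) : IsCrossedHom a c a'' c'' (f ≫ g) where
  act := by rw [reassoc_of% hf.act, hg.act, comp_whiskerRight_assoc]
  coact := by rw [Category.assoc, hg.coact, reassoc_of% hf.coact, comp_whiskerRight]

theorem inv {f : V ≅ W} (hf : IsCrossedHom a c a' c' f.hom) : IsCrossedHom a' c' a c f.inv where
  act := by
    rw [Iso.comp_inv_eq, Category.assoc, hf.act, ← comp_whiskerRight_assoc, f.inv_hom_id,
      id_whiskerRight, Category.id_comp]
  coact := by
    rw [Iso.inv_comp_eq, reassoc_of% hf.coact, ← comp_whiskerRight, f.hom_inv_id,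
      id_whiskerRight, Category.comp_id]

theorem act_iff {f : V ⟶ W} : a ≫ f = f ▷ H ≫ a' ↔
    ∀ Z, mulAt a Z ≫ f ▷ Z = f ▷ (H ⊗ Z) ≫ mulAt a' Z := by
  constructor
  · intro h Z
    have := congr((α_ _ _ _).inv ≫ $h ▷ Z)
    simpa [mulAt] using this
  · intro h
    apply eq_of_whiskerRight_unit
    have := congr((α_ _ _ _).hom ≫ $(h (𝟙_ C)))
    simpa [mulAt] using this

theorem coact_iff {f : V ⟶ W} : f ≫ c' = c ≫ f ▷ H ↔
    ∀ Z, f ▷ Z ≫ comulAt c' Z = comulAt c Z ≫ f ▷ (H ⊗ Z) := by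
  constructor
  · intro h Z
    have := congr($h ▷ Z ≫ (α_ _ _ _).hom)
    simpa [comulAt] using this
  · intro h
    apply eq_of_whiskerRight_unit
    have := congr($(h (𝟙_ C)) ≫ (α_ _ _ _).inv)
    simpa [comulAt] using this

variable [BraidedCategory C]

section

variable [HopfObj H] {V' W' : C} {b : V' ⊗ H ⟶ V'} {d : V' ⟶ V' ⊗ H} {b' : W' ⊗ H ⟶ W'}
  {d' : W' ⟶ W' ⊗ H}

/-- The tensor product of two module morphisms is one for the diagonal actions. -/
theorem diagActR_comp {f : V ⟶ W} {g : V' ⟶ W'} (hf : a ≫ f = f ▷ H ≫ a')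
    (hg : b ≫ g = g ▷ H ≫ b') :
    diagActR a b ≫ (f ⊗ₘ g) = (f ⊗ₘ g) ▷ H ≫ diagActR a' b' := by
  have h := tensorμ_natural f g (𝟙 H) (𝟙 H)
  simp only [tensorHom_id, id_whiskerRight] at h
  simp only [diagActR, Category.assoc, MonoidalCategory.tensorHom_comp_tensorHom, hf, hg]
  rw [← MonoidalCategory.tensorHom_comp_tensorHom, ← reassoc_of% h]
  rw [whisker_exchange_assoc]

/-- The tensor product of two comodule morphisms is one for the diagonal coactions. -/
theorem comp_diagCoactR {f : V ⟶ W} {g : V' ⟶ W'} (hf : f ≫ c' = c ≫ f ▷ H)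
    (hg : g ≫ d' = d ≫ g ▷ H) :
    (f ⊗ₘ g) ≫ diagCoactR c' d' = diagCoactR c d ≫ (f ⊗ₘ g) ▷ H := by
  have h := tensorμ_natural f (𝟙 H) g (𝟙 H)
  simp only [tensorHom_id, id_whiskerRight] at h
  simp only [diagCoactR, Category.assoc, MonoidalCategory.tensorHom_comp_tensorHom_assoc, hf, hg]
  rw [← MonoidalCategory.tensorHom_comp_tensorHom, Category.assoc, reassoc_of% h]
  simp only [whisker_exchange]

/-- The associativity of the diagonal structures; this uses only the coassociativity of `Δ` and
the associativity of `μ`. -/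
theorem associator (a : V ⊗ H ⟶ V) (c : V ⟶ V ⊗ H) (b : V' ⊗ H ⟶ V') (d : V' ⟶ V' ⊗ H)
    (b' : W' ⊗ H ⟶ W') (d' : W' ⟶ W' ⊗ H) :
    IsCrossedHom (diagActR (diagActR a b) b') (diagCoactR (diagCoactR c d) d')
      (diagActR a (diagActR b b')) (diagCoactR c (diagCoactR d d')) (α_ V V' W').hom where
  act := by
    rw [act_iff]
    intro Z
    simp only [diagActR_at, associator_whiskerRight, tensor_whiskerLeft, whiskerLeft_comp,
      Category.assoc, Iso.inv_hom_id_assoc, braidAt_tensor_left, whiskerLeft_inv_hom_assoc]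
    simp only [mulAt_nat_assoc a]
    simp only [← whiskerLeft_comp_assoc V, whiskerLeft_inv_hom_assoc, braidAt_nat_assoc]
    simp only [← whiskerLeft_comp_assoc V', braidAt_comulAt, braidAt_nat_assoc]
    simp only [← whiskerLeft_comp_assoc W', comul_assoc_at]
  coact := by
    rw [coact_iff]
    intro Z
    simp only [diagCoactR_at, associator_whiskerRight, tensor_whiskerLeft, whiskerLeft_comp,
      Category.assoc, Iso.inv_hom_id_assoc, braidAt_tensor_right, whiskerLeft_inv_hom_assoc]
    simp only [← comulAt_nat_assoc c]
    simp only [← whiskerLeft_comp_assoc V, whiskerLeft_inv_hom_assoc, ← braidAt_nat_assoc]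
    simp only [← whiskerLeft_comp_assoc V', mulAt_braidAt_assoc, ← braidAt_nat_assoc]
    simp only [← whiskerLeft_comp W', mul_assoc_at]

end

end IsCrossedHom

end CrossedHom

/-! ### Morphisms of Hopf bimodules and their restriction to the invariants -/

section

variable {C : Type u} [Category.{v} C] [MonoidalCategory C] [BraidedCategory C]
variable {H : C} [HopfObj H]

namespace HopfBimodule

@[simp]
theorem id_hom (X : HopfBimodule H) : Hom.hom (𝟙 X) = 𝟙 X.pt := rfl

@[simp]
theorem comp_hom {X Y Z : HopfBimodule H} (f : X ⟶ Y) (g : Y ⟶ Z) :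
    (f ≫ g).hom = f.hom ≫ g.hom := rfl

@[ext]
theorem hom_ext {X Y : HopfBimodule H} {f g : X ⟶ Y} (h : f.hom = g.hom) : f = g := Hom.ext h

/-- The Hopf bimodule `X ⊗ V`, for a crossed module `V`. -/
abbrev tensor (X : HopfBimodule H) {V : C} {a : V ⊗ H ⟶ V} {c : V ⟶ V ⊗ H} (h : IsCrossed a c) :
    HopfBimodule H :=
  ⟨_, isHopfBimodule_tensor X h⟩

section

variable {V W : C} {a : V ⊗ H ⟶ V} {c : V ⟶ V ⊗ H} {h : IsCrossed a c}
  {a' : W ⊗ H ⟶ W} {c' : W ⟶ W ⊗ H} {h' : IsCrossed a' c'}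

/-- The morphism `f ⊗ φ`, for a morphism `f` of Hopf bimodules and a morphism `φ` of crossed
modules. -/
@[simps hom]
def tensorMap {X Y : HopfBimodule H} (f : X ⟶ Y) {φ : V ⟶ W} (hφ : IsCrossedHom a c a' c' φ) :
    X.tensor h ⟶ Y.tensor h' where
  hom := f.hom ⊗ₘ φ
  actL_hom := actL_tensorHom f.actL_hom φ
  actR_hom := IsCrossedHom.diagActR_comp f.actR_hom hφ.act
  hom_coactL := tensorHom_coactL f.hom_coactL φ
  hom_coactR := IsCrossedHom.comp_diagCoactR f.hom_coactR hφ.coact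

end

/-- A morphism of Hopf bimodules is invertible if its underlying morphism is. -/
@[simps]
def isoOfHom {X Y : HopfBimodule H} (f : X ⟶ Y) (g : Y.pt ⟶ X.pt) (hfg : f.hom ≫ g = 𝟙 _)
    (hgf : g ≫ f.hom = 𝟙 _) : X ≅ Y where
  hom := f
  inv := {
    hom := g
    actL_hom := by
      have : IsIso f.hom := ⟨g, hfg, hgf⟩
      rw [← cancel_mono f.hom, Category.assoc, hgf, Category.assoc, f.actL_hom,
        ← whiskerLeft_comp_assoc, hgf]
      simp
    actR_hom := by
      have : IsIso f.hom := ⟨g, hfg, hgf⟩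
      rw [← cancel_mono f.hom, Category.assoc, hgf, Category.assoc, f.actR_hom,
        ← comp_whiskerRight_assoc, hgf]
      simp
    hom_coactL := by
      have : IsIso f.hom := ⟨g, hfg, hgf⟩
      rw [← cancel_epi f.hom, reassoc_of% hfg, ← Category.assoc, f.hom_coactL, Category.assoc,
        ← whiskerLeft_comp, hfg]
      simp
    hom_coactR := by
      have : IsIso f.hom := ⟨g, hfg, hgf⟩
      rw [← cancel_epi f.hom, reassoc_of% hfg, ← Category.assoc, f.hom_coactR, Category.assoc,
        ← comp_whiskerRight, hfg]
      simp }
  hom_inv_id := hom_ext hfg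
  inv_hom_id := hom_ext hgf

theorem proj_hom {X Y : HopfBimodule H} (f : X ⟶ Y) : X.proj ≫ f.hom = f.hom ≫ Y.proj := by
  simp only [proj, Category.assoc, f.actL_hom, ← whisker_exchange_assoc, reassoc_of% f.hom_coactL]

theorem proj_hom_assoc : type_of% (reassoc_of% @proj_hom) :=
  @(reassoc_of% @proj_hom)

theorem coactL_proj_actL (X : HopfBimodule H) : X.coactL ≫ H ◁ X.proj ≫ X.actL = 𝟙 _ := by
  apply eq_of_whiskerRight_unit
  simpa [comulAt, mulAt] using X.coactL_proj_actL_at (𝟙_ C)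

theorem coactL_proj_actL_assoc : type_of% (reassoc_of% @coactL_proj_actL) :=
  @(reassoc_of% @coactL_proj_actL)

end HopfBimodule

namespace InvariantSplitting

attribute [simp] i_p

theorem i_p_assoc : type_of% (reassoc_of% @i_p) :=
  @(reassoc_of% @i_p)

attribute [simp] i_p_assoc

theorem p_i_assoc : type_of% (reassoc_of% @p_i) :=
  @(reassoc_of% @p_i)

variable {X Y Z : HopfBimodule H} (s : InvariantSplitting X) (t : InvariantSplitting Y)
  (r : InvariantSplitting Z)

theorem proj_p : X.proj ≫ s.p = s.p := by
  rw [← s.p_i, Category.assoc, s.i_p, Category.comp_id]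

theorem i_proj : s.i ≫ X.proj = s.i := by
  rw [← s.p_i, s.i_p_assoc]

theorem i_proj_assoc : type_of% (reassoc_of% @i_proj) :=
  @(reassoc_of% @i_proj)

theorem p_act : s.p ▷ H ≫ s.act = X.actR ≫ s.p := by
  rw [eq_comm, IsCrossedHom.act_iff]
  exact fun Z => (s.p_act_at Z).symm

theorem i_coactR : s.i ≫ X.coactR = s.coact ≫ s.i ▷ H := by
  rw [IsCrossedHom.coact_iff]
  exact s.i_coactR_at

/-- The projection to the invariants sends `h x` to `ε(h)` times the image of `x`. -/
theorem actL_p : X.actL ≫ s.p = ε[H] ▷ X.pt ≫ (λ_ _).hom ≫ s.p := by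
  apply eq_of_whiskerRight_unit
  have := s.actL_p_at (𝟙_ C)
  simp only [mulAt, counitAt, Category.assoc, Iso.inv_comp_eq] at this
  simp only [comp_whiskerRight, this]
  monoidal

/-- The left coaction is trivial on the invariants. -/
theorem i_coactL : s.i ≫ X.coactL = s.i ≫ (λ_ _).inv ≫ η[H] ▷ X.pt := by
  apply eq_of_whiskerRight_unit
  have := s.i_coactL_at (𝟙_ C)
  simp only [comulAt, oneAt, ← Category.assoc, ← Iso.eq_comp_inv] at this
  simp only [comp_whiskerRight, this, Category.assoc]
  monoidal

theorem i_coactL_assoc : type_of% (reassoc_of% @i_coactL) :=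
  @(reassoc_of% @i_coactL)

/-- The morphism induced on the invariants by a morphism of Hopf bimodules. -/
def map (f : X ⟶ Y) : s.inv ⟶ t.inv := s.i ≫ f.hom ≫ t.p

theorem map_i (f : X ⟶ Y) : s.map t f ≫ t.i = s.i ≫ f.hom := by
  simp only [map, Category.assoc, t.p_i]
  rw [← HopfBimodule.proj_hom, s.i_proj_assoc]

theorem map_i_assoc : type_of% (reassoc_of% @map_i) :=
  @(reassoc_of% @map_i)

theorem p_map (f : X ⟶ Y) : s.p ≫ s.map t f = f.hom ≫ t.p := by
  simp only [map, s.p_i_assoc]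
  rw [HopfBimodule.proj_hom_assoc, t.proj_p]

@[simp]
theorem map_id : s.map s (𝟙 X) = 𝟙 _ := by simp [map]

theorem map_comp (f : X ⟶ Y) (g : Y ⟶ Z) : s.map r (f ≫ g) = s.map t f ≫ t.map r g := by
  simp [map, t.p_i_assoc, HopfBimodule.proj_hom_assoc, r.proj_p]

/-- A morphism of Hopf bimodules is determined by its restriction to the invariants. -/
theorem hom_eq (f : X ⟶ Y) : f.hom = X.coactL ≫ H ◁ (s.p ≫ s.map t f ≫ t.i) ≫ Y.actL := by
  rw [map_i, s.p_i_assoc, whiskerLeft_comp_assoc, ← f.actL_hom, X.coactL_proj_actL_assoc]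

/-- Restriction to the invariants is faithful, since a Hopf bimodule is generated by them. -/
theorem map_injective {f g : X ⟶ Y} (h : s.map t f = s.map t g) : f = g := by
  ext
  rw [hom_eq s t, h, ← hom_eq s t]

theorem isCrossedHom_map (f : X ⟶ Y) :
    IsCrossedHom s.act s.coact t.act t.coact (s.map t f) where
  act := by
    have : IsSplitEpi (s.p ▷ H) := ⟨⟨s.i ▷ H, by simp [← comp_whiskerRight]⟩⟩
    rw [← cancel_epi (s.p ▷ H), ← Category.assoc, s.p_act, Category.assoc, s.p_map,
      reassoc_of% f.actR_hom, ← comp_whiskerRight_assoc, s.p_map, comp_whiskerRight_assoc, t.p_act]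
  coact := by
    have : IsSplitMono (t.i ▷ H) := ⟨⟨t.p ▷ H, by simp [← comp_whiskerRight]⟩⟩
    rw [← cancel_mono (t.i ▷ H), Category.assoc, ← t.i_coactR, s.map_i_assoc, f.hom_coactR,
      Category.assoc, ← comp_whiskerRight, s.map_i, comp_whiskerRight,
      ← Category.assoc, s.i_coactR, Category.assoc]

end InvariantSplitting

end

/-! ### Hopf bimodules are free over their invariants -/

section

variable {C : Type u} [Category.{v} C] [MonoidalCategory C] [BraidedCategory C]

variable {H : C} [HopfObj H]

namespace InvariantSplitting

variable {X Y : HopfBimodule H} (s : InvariantSplitting X) (t : InvariantSplitting Y)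

theorem actL_i_at (Z : C) : (H ◁ s.i ≫ X.actL) ▷ Z =
    (α_ _ _ _).hom ≫ H ◁ s.i ▷ Z ≫ mulAt X.actL Z := by
  simp [mulAt]

/-- The morphism `H ⊗ inv X ⟶ X`, `h ⊗ v ↦ h v`. -/
def leftUnitorHom : (HopfBimodule.regular H).tensor s.isCrossed ⟶ X where
  hom := H ◁ s.i ≫ X.actL
  actL_hom := by
    change ((α_ H H s.inv).inv ≫ μ[H] ▷ s.inv) ≫ (H ◁ s.i ≫ X.actL) =
      H ◁ (H ◁ s.i ≫ X.actL) ≫ X.actL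
    rw [actL_comp_iff]
    intro Z
    simp only [actL_i_at, whiskerRight_actL_at, Category.assoc, Iso.inv_hom_id_assoc,
      mulAt_nat_assoc, X.mul_actL_at, whiskerLeft_comp]
  actR_hom := by
    change diagActR μ[H] s.act ≫ (H ◁ s.i ≫ X.actL) = (H ◁ s.i ≫ X.actL) ▷ H ≫ X.actR
    rw [IsCrossedHom.act_iff]
    intro Z
    simp only [actL_i_at, diagActR_at, Category.assoc, Iso.inv_hom_id_assoc, X.actL_actR_at]
    simp only [← whiskerLeft_comp_assoc H, s.i_actR_at]
    simp only [whiskerLeft_comp, Category.assoc, X.mul_actL_at, mulAt_nat_assoc]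
  hom_coactL := by
    change (H ◁ s.i ≫ X.actL) ≫ X.coactL =
      (Δ[H] ▷ s.inv ≫ (α_ H H s.inv).hom) ≫ H ◁ (H ◁ s.i ≫ X.actL)
    rw [comp_coactL_iff]
    intro Z
    simp only [actL_i_at, whiskerRight_coactL_at, Category.assoc, X.actL_coactL_at,
      whiskerLeft_inv_hom_assoc, whiskerLeft_comp]
    simp only [← whiskerLeft_comp_assoc H, ← whiskerLeft_comp H, s.i_coactL_at]
    simp only [whiskerLeft_comp, Category.assoc, ← comulAt_nat_assoc]
    simp only [← whiskerLeft_comp_assoc H, ← whiskerLeft_comp H, whiskerLeft_oneAt_braidAt]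
    simp only [whiskerLeft_comp, Category.assoc, mul_one_at_assoc]
  hom_coactR := by
    change (H ◁ s.i ≫ X.actL) ≫ X.coactR = diagCoactR Δ[H] s.coact ≫ (H ◁ s.i ≫ X.actL) ▷ H
    rw [IsCrossedHom.coact_iff]
    intro Z
    simp only [actL_i_at, diagCoactR_at, Category.assoc, Iso.inv_hom_id_assoc, X.actL_coactR_at]
    simp only [← whiskerLeft_comp_assoc H, s.i_coactR_at]
    simp only [whiskerLeft_comp, Category.assoc, ← comulAt_nat_assoc]
    simp only [← whiskerLeft_comp_assoc H, whiskerLeft_whiskerRight_braidAt, whisker_exchange]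
    simp only [whiskerLeft_comp, Category.assoc, ← mulAt_nat]

theorem i_actL_coactL_p_at (Z : C) :
    H ◁ s.i ▷ Z ≫ mulAt X.actL Z ≫ comulAt X.coactL Z ≫ H ◁ s.p ▷ Z = 𝟙 _ := by
  rw [X.actL_coactL_at_assoc]
  simp only [← whiskerLeft_comp_assoc H, ← whiskerLeft_comp H, s.i_coactL_at, s.actL_p_at]
  simp only [whiskerLeft_comp, Category.assoc, ← comulAt_nat_assoc]
  simp only [← whiskerLeft_comp_assoc H, ← whiskerLeft_comp H, whiskerLeft_oneAt_braidAt]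
  simp only [whiskerLeft_comp, Category.assoc, mul_one_at_assoc]
  simp only [← whiskerLeft_comp H, ← counitAt_nat_assoc, s.i_p_at, Category.comp_id]
  rw [comul_counit_at]

/-- Every Hopf bimodule is free over its invariants: `H ⊗ inv X ≅ X`. The inverse is
`x ↦ x₋₁ ⊗ p(x₀)`. -/
@[simps! hom inv_hom]
def leftUnitorIso : (HopfBimodule.regular H).tensor s.isCrossed ≅ X :=
  HopfBimodule.isoOfHom s.leftUnitorHom (X.coactL ≫ H ◁ s.p)
    (by
      change (H ◁ s.i ≫ X.actL) ≫ X.coactL ≫ H ◁ s.p = 𝟙 (H ⊗ s.inv)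
      apply eq_of_whiskerRight_unit
      have := congr((α_ _ _ _).hom ≫ $(s.i_actL_coactL_p_at (𝟙_ C)) ≫ (α_ _ _ _).inv)
      simpa [mulAt, comulAt] using this)
    (by
      change (X.coactL ≫ H ◁ s.p) ≫ (H ◁ s.i ≫ X.actL) = 𝟙 X.pt
      rw [Category.assoc, ← whiskerLeft_comp_assoc, s.p_i, X.coactL_proj_actL])

/-- The morphism of Hopf bimodules with a given restriction `φ` to the invariants; it is `id ⊗ φ`
under the isomorphisms `H ⊗ inv X ≅ X` and `H ⊗ inv Y ≅ Y`. -/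
def lift {φ : s.inv ⟶ t.inv} (hφ : IsCrossedHom s.act s.coact t.act t.coact φ) : X ⟶ Y :=
  s.leftUnitorIso.inv ≫ HopfBimodule.tensorMap (𝟙 _) hφ ≫ t.leftUnitorHom

theorem lift_hom {φ : s.inv ⟶ t.inv} (hφ : IsCrossedHom s.act s.coact t.act t.coact φ) :
    (s.lift t hφ).hom = X.coactL ≫ H ◁ (s.p ≫ φ ≫ t.i) ≫ Y.actL := by
  change (X.coactL ≫ H ◁ s.p) ≫ (𝟙 H ⊗ₘ φ) ≫ (H ◁ t.i ≫ Y.actL) = _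
  simp

@[simp]
theorem map_lift {φ : s.inv ⟶ t.inv} (hφ : IsCrossedHom s.act s.coact t.act t.coact φ) :
    s.map t (s.lift t hφ) = φ := by
  rw [map, lift_hom, Category.assoc, s.i_coactL_assoc, Category.assoc, actL_p,
    ← whisker_exchange_assoc, ← comp_whiskerRight_assoc]
  simp

section Tensor

variable {V : C} {a : V ⊗ H ⟶ V} {c : V ⟶ V ⊗ H} {h : IsCrossed a c}
  (r : InvariantSplitting (X.tensor h))

/-- The idempotent of `X ⊗ V` involves the left structures only, which are those of `X`. -/
theorem proj_tensor : (X.tensor h).proj = X.proj ▷ V := by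
  change (X.coactL ▷ V ≫ (α_ H X.pt V).hom) ≫ 𝒮[H] ▷ (X.pt ⊗ V) ≫ (α_ H X.pt V).inv ≫ X.actL ▷ V = _
  simp [HopfBimodule.proj]

/-- The invariants of `X ⊗ V` are `inv X ⊗ V`. -/
def tensorIso : s.inv ⊗ V ≅ r.inv where
  hom := s.i ▷ V ≫ r.p
  inv := r.i ≫ s.p ▷ V
  hom_inv_id := by
    rw [Category.assoc, r.p_i_assoc, proj_tensor]
    change s.i ▷ V ≫ X.proj ▷ V ≫ s.p ▷ V = 𝟙 (s.inv ⊗ V)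
    rw [i_proj_at_assoc, i_p_at]
  inv_hom_id := by
    rw [Category.assoc]
    rw [s.p_i_at_assoc, ← proj_tensor (h := h), r.proj_p, r.i_p]

theorem tensorIso_hom : (s.tensorIso r).hom = s.i ▷ V ≫ r.p := rfl

theorem tensorIso_inv : (s.tensorIso r).inv = r.i ≫ s.p ▷ V := rfl

/-- Under `inv X ⊗ V ≅ inv (X ⊗ V)`, the inclusion of the invariants is `i ⊗ V`. -/
theorem tensorIso_hom_i : (s.tensorIso r).hom ≫ r.i = s.i ▷ V := by
  rw [tensorIso_hom, Category.assoc, r.p_i, proj_tensor]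
  exact s.i_proj_at V

theorem p_tensorIso_inv : r.p ≫ (s.tensorIso r).inv = s.p ▷ V := by
  rw [tensorIso_inv, r.p_i_assoc, proj_tensor]
  exact s.proj_p_at V

theorem p_tensorIso_inv_assoc : type_of% (reassoc_of% @p_tensorIso_inv) :=
  @(reassoc_of% @p_tensorIso_inv)

theorem p_tensorIso_hom : s.p ▷ V ≫ (s.tensorIso r).hom = r.p := by
  rw [← p_tensorIso_inv, Category.assoc, Iso.inv_hom_id, Category.comp_id]

theorem tensorIso_inv_i : (s.tensorIso r).inv ≫ s.i ▷ V = r.i := by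
  rw [← tensorIso_hom_i, Iso.inv_hom_id_assoc]

theorem tensorIso_inv_i_assoc : type_of% (reassoc_of% @tensorIso_inv_i) :=
  @(reassoc_of% @tensorIso_inv_i)

/-- The action and coaction on the invariants of `X ⊗ V` are the diagonal ones. -/
theorem isCrossedHom_tensorIso_inv :
    IsCrossedHom r.act r.coact (diagActR s.act a) (diagCoactR s.coact c) (s.tensorIso r).inv where
  act := by
    have : IsSplitEpi (r.p ▷ H) := ⟨⟨r.i ▷ H, by simp [← comp_whiskerRight]⟩⟩
    rw [← cancel_epi (r.p ▷ H), ← Category.assoc, r.p_act, Category.assoc, p_tensorIso_inv,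
      ← comp_whiskerRight_assoc, p_tensorIso_inv]
    have := IsCrossedHom.diagActR_comp (f := s.p) (a := X.actR) (a' := s.act) s.p_act.symm
      (IsCrossedHom.id a c).act
    simpa using this
  coact := by
    have : IsSplitMono (s.i ▷ V ▷ H) :=
      ⟨⟨s.p ▷ V ▷ H, by simp only [← comp_whiskerRight, i_p, id_whiskerRight]⟩⟩
    rw [← cancel_mono (s.i ▷ V ▷ H), Category.assoc, Category.assoc, ← comp_whiskerRight,
      tensorIso_inv_i, ← r.i_coactR]
    have := IsCrossedHom.comp_diagCoactR (f := s.i) (c := s.coact) (c' := X.coactR) s.i_coactR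
      (IsCrossedHom.id a c).coact
    simp only [tensorHom_id] at this
    rw [← this, tensorIso_inv_i_assoc]

end Tensor

end InvariantSplitting

end

/-! ### The braiding of crossed modules -/

section CrossBraid

variable {C : Type u} [Category.{v} C] [MonoidalCategory C] [BraidedCategory C]

/-- The braiding of crossed modules, `v ⊗ w ↦ w₀ ⊗ (v ◁ w₁)`. Only the action on the first factor
and the coaction on the second enter. -/
def crossBraid {H V W : C} (a : V ⊗ H ⟶ V) (d : W ⟶ W ⊗ H) : V ⊗ W ⟶ W ⊗ V :=
  V ◁ d ≫ (α_ V W H).inv ≫ (β_ V W).hom ▷ H ≫ (α_ W V H).hom ≫ W ◁ a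

theorem crossBraid_at {H V W : C} (a : V ⊗ H ⟶ V) (d : W ⟶ W ⊗ H) (Z : C) :
    crossBraid a d ▷ Z = (α_ _ _ _).hom ≫ V ◁ comulAt d Z ≫ braidAt V W (H ⊗ Z) ≫
      W ◁ mulAt a Z ≫ (α_ _ _ _).inv := by
  simp [crossBraid, mulAt, comulAt, braidAt]

/-- The braiding of crossed modules as the braiding of `C` followed by an endomorphism of `W ⊗ V`,
which uses the left action of the opposite algebra on `V`. -/
theorem crossBraid_eq {H V W : C} (a : V ⊗ H ⟶ V) (d : W ⟶ W ⊗ H) : crossBraid a d =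
    (β_ V W).hom ≫ d ▷ V ≫ (α_ _ _ _).hom ≫ W ◁ ((β_ V H).inv ≫ a) := by
  rw [← BraidedCategory.braiding_naturality_right_assoc]
  simp [crossBraid]

/-- Naturality in the first variable, with respect to module morphisms. -/
theorem whiskerRight_crossBraid {H V V' W : C} {a : V ⊗ H ⟶ V} {a' : V' ⊗ H ⟶ V'}
    (d : W ⟶ W ⊗ H) {f : V ⟶ V'} (h : a ≫ f = f ▷ H ≫ a') :
    f ▷ W ≫ crossBraid a' d = crossBraid a d ≫ W ◁ f := by
  simp only [crossBraid, ← whisker_exchange_assoc, Category.assoc, ← whiskerLeft_comp, h]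
  simp [← comp_whiskerRight_assoc]

theorem whiskerRight_crossBraid_assoc : type_of% (reassoc_of% @whiskerRight_crossBraid) :=
  @(reassoc_of% @whiskerRight_crossBraid)

/-- Naturality in the second variable, with respect to comodule morphisms. -/
theorem whiskerLeft_crossBraid {H V W W' : C} (a : V ⊗ H ⟶ V) {d : W ⟶ W ⊗ H}
    {d' : W' ⟶ W' ⊗ H} {f : W ⟶ W'} (h : f ≫ d' = d ≫ f ▷ H) :
    V ◁ f ≫ crossBraid a d' = crossBraid a d ≫ f ▷ V := by
  simp only [crossBraid, ← whiskerLeft_comp_assoc, h, Category.assoc, whisker_exchange]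
  rw [← associator_naturality_left_assoc, ← comp_whiskerRight_assoc,
    ← BraidedCategory.braiding_naturality_right]
  simp only [whiskerLeft_comp, comp_whiskerRight, Category.assoc,
    associator_inv_naturality_middle_assoc]

theorem whiskerLeft_crossBraid_assoc : type_of% (reassoc_of% @whiskerLeft_crossBraid) :=
  @(reassoc_of% @whiskerLeft_crossBraid)

variable {H : C} [HopfObj H] {U V W : C} {e : U ⊗ H ⟶ U} {a : V ⊗ H ⟶ V} {c : V ⟶ V ⊗ H}
  {b : W ⊗ H ⟶ W} {d : W ⟶ W ⊗ H}

/-- The braiding is a morphism of crossed modules for the diagonal structures. The action is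
respected by the crossed module law of `W`, the coaction by that of `V`. -/
theorem isCrossedHom_crossBraid (hV : IsCrossed a c) (hW : IsCrossed b d) :
    IsCrossedHom (diagActR a b) (diagCoactR c d) (diagActR b a) (diagCoactR d c)
      (crossBraid a d) where
  act := by
    rw [IsCrossedHom.act_iff]
    intro Z
    simp only [crossBraid_at, diagActR_at, Category.assoc, Iso.inv_hom_id_assoc]
    simp only [mulAt_nat_assoc a, mulAt_braidAt_assoc]
    simp only [← whiskerLeft_comp_assoc W, ← hV.act_mul, mulAt_nat_assoc a]
    simp only [mulAt_braidAt]
    simp only [whiskerLeft_comp, Category.assoc, ← mulAt_nat_assoc b]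
    simp only [← whiskerLeft_comp_assoc W, ← hV.act_mul]
    simp only [whiskerLeft_comp, Category.assoc, braidAt_nat_assoc]
    simp only [← whiskerLeft_comp_assoc W]
    simp only [whiskerLeft_comp, Category.assoc, mulAt_nat_assoc b]
    simp only [← whiskerLeft_comp_assoc W, braidAt_nat_assoc]
    simp only [whiskerLeft_comp, Category.assoc, braidAt_nat_assoc]
    -- The action on `w` followed by the coaction is exchanged by the crossed module law.
    simp only [← whiskerLeft_comp_assoc V, ← whiskerLeft_comp_assoc H, ← hW.crossed]
    simp only [whiskerLeft_comp, Category.assoc, ← mulAt_nat_assoc b]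
    simp only [← whiskerLeft_mulAt_braidAt_assoc]
    simp only [← whiskerLeft_comp_assoc V, comulAt_nat_assoc d, ← mulAt_nat b]
  coact := by
    rw [IsCrossedHom.coact_iff]
    intro Z
    simp only [crossBraid_at, diagCoactR_at, Category.assoc, Iso.inv_hom_id_assoc]
    simp only [← comulAt_nat_assoc d, braidAt_comulAt_assoc]
    simp only [← whiskerLeft_comp_assoc V, ← comulAt_nat d, braidAt_comulAt_assoc]
    simp only [← hW.coact_comul]
    simp only [whiskerLeft_comp, Category.assoc, ← comulAt_nat_assoc c]
    simp only [← whiskerLeft_comp_assoc V, ← whiskerLeft_comp_assoc H, ← hW.coact_comul]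
    simp only [whiskerLeft_comp, Category.assoc, ← braidAt_nat_assoc]
    -- The action of `w₁` on `v` followed by the coaction is exchanged by the crossed module law.
    simp only [← whiskerLeft_comp_assoc W, ← whiskerLeft_comp_assoc H, ← hV.crossed]
    simp only [whiskerLeft_comp, Category.assoc, comulAt_nat_assoc c]
    simp only [← braidAt_whiskerLeft_comulAt_assoc]
    simp only [← whiskerLeft_comp_assoc W, comulAt_nat_assoc c, ← mulAt_nat a]

/-- The hexagon identity for a tensor product in the first variable, from the coassociativity of the
coaction of `W`. -/
theorem crossBraid_diagActR (hW : IsCrossed b d) :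
    crossBraid (diagActR e a) d = (α_ U V W).hom ≫ U ◁ crossBraid a d ≫ (α_ _ _ _).inv ≫
      crossBraid e d ▷ V ≫ (α_ _ _ _).hom := by
  apply eq_of_whiskerRight_unit
  have hw {A B : C} (f : A ⟶ B) (K L : C) :
      f ▷ K ▷ L = (α_ _ _ _).hom ≫ f ▷ (K ⊗ L) ≫ (α_ _ _ _).inv := by simp
  generalize 𝟙_ C = Z
  have hi (A B D : C) : (α_ A B D).inv ▷ Z =
    (α_ _ _ _).hom ≫ A ◁ (α_ _ _ _).hom ≫ (α_ _ _ _).inv ≫ (α_ _ _ _).inv := by monoidal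
  simp only [comp_whiskerRight, whisker_assoc, hw]
  simp only [crossBraid_at, diagActR_at, associator_whiskerRight, Category.assoc,
    braidAt_tensor_left, tensor_whiskerLeft, whiskerLeft_comp, whiskerLeft_inv_hom_assoc,
    Iso.inv_hom_id_assoc]
  simp only [hi, Category.assoc, Iso.inv_hom_id_assoc, whiskerLeft_inv_hom_assoc]
  simp only [← whiskerLeft_comp_assoc U, ← comulAt_nat d, braidAt_comulAt_assoc]
  simp only [← whiskerLeft_comp_assoc V, ← hW.coact_comul]
  simp only [whiskerLeft_comp, Category.assoc]
  simp only [braidAt_nat_assoc]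
  simp only [← whiskerLeft_comp_assoc W]
  simp only [whiskerLeft_comp, Category.assoc, ← braidAt_nat_assoc]
  simp only [← whiskerLeft_comp_assoc U, ← braidAt_nat]
  simp only [whiskerLeft_comp, Category.assoc, ← braidAt_nat_assoc]
  simp only [← whiskerLeft_comp_assoc W, ← mulAt_nat_assoc e]

/-- The hexagon identity for a tensor product in the second variable, from the associativity of the
action of `V`. -/
theorem crossBraid_diagCoactR (hV : IsCrossed a c) (f : U ⟶ U ⊗ H) :
    crossBraid a (diagCoactR d f) = (α_ V W U).inv ≫ crossBraid a d ▷ U ≫ (α_ _ _ _).hom ≫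
      W ◁ crossBraid a f ≫ (α_ _ _ _).inv := by
  apply eq_of_whiskerRight_unit
  have hw {A B : C} (f : A ⟶ B) (K L : C) :
      f ▷ K ▷ L = (α_ _ _ _).hom ≫ f ▷ (K ⊗ L) ≫ (α_ _ _ _).inv := by simp
  generalize 𝟙_ C = Z
  have hi (A B D : C) : (α_ A B D).inv ▷ Z =
    (α_ _ _ _).hom ≫ A ◁ (α_ _ _ _).hom ≫ (α_ _ _ _).inv ≫ (α_ _ _ _).inv := by monoidal
  simp only [comp_whiskerRight, whisker_assoc, hw]
  simp only [crossBraid_at, diagCoactR_at, associator_whiskerRight, Category.assoc,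
    braidAt_tensor_right, tensor_whiskerLeft, whiskerLeft_comp, whiskerLeft_inv_hom_assoc,
    Iso.inv_hom_id_assoc]
  simp only [hi, Category.assoc, Iso.inv_hom_id_assoc, whiskerLeft_inv_hom_assoc]
  simp only [← whiskerLeft_comp_assoc W, mulAt_nat_assoc a, mulAt_braidAt_assoc]
  simp only [← whiskerLeft_comp U, ← hV.act_mul]
  simp only [whiskerLeft_comp, Category.assoc]
  simp only [← whiskerLeft_comp_assoc V, ← comulAt_nat_assoc d]
  simp only [whiskerLeft_comp, Category.assoc, ← braidAt_nat_assoc]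
  simp only [← whiskerLeft_comp_assoc W, ← braidAt_nat_assoc]

end CrossBraid

/-! ### Invertibility of the braiding of crossed modules -/

section CrossBraid

variable {C : Type u} [Category.{v} C] [MonoidalCategory C] [BraidedCategory C]
variable {H : C} [HopfObj H]

section

theorem braiding_inv_mul_antipode :
    (β_ H H).inv ≫ μ[H] ≫ 𝒮[H] = (𝒮[H] ⊗ₘ 𝒮[H]) ≫ μ[H] := by
  rw [Iso.inv_comp_eq, HopfObj.mul_antipode, ← BraidedCategory.braiding_naturality_assoc]

variable [IsIso 𝒮[H]]

/-- The inverse of the antipode is a left antipode for the opposite multiplication `β⁻¹ ≫ μ`. -/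
theorem comul_inv_antipode_left :
    Δ[H] ≫ inv 𝒮[H] ▷ H ≫ (β_ H H).inv ≫ μ[H] = ε[H] ≫ η[H] := by
  rw [← cancel_mono 𝒮[H]]
  simp only [Category.assoc, braiding_inv_mul_antipode, MonoidalCategory.tensorHom_def,
    ← comp_whiskerRight_assoc, IsIso.inv_hom_id, id_whiskerRight, Category.id_comp,
    HopfObj.antipode_right, HopfObj.one_antipode]

/-- The inverse of the antipode is a right antipode for the opposite multiplication `β⁻¹ ≫ μ`. -/
theorem comul_inv_antipode_right :
    Δ[H] ≫ H ◁ inv 𝒮[H] ≫ (β_ H H).inv ≫ μ[H] = ε[H] ≫ η[H] := by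
  rw [← cancel_mono 𝒮[H]]
  simp only [Category.assoc, braiding_inv_mul_antipode, MonoidalCategory.tensorHom_def',
    ← whiskerLeft_comp_assoc, IsIso.inv_hom_id, whiskerLeft_id, Category.id_comp,
    HopfObj.antipode_left, HopfObj.one_antipode]

end

variable {V W : C} {a : V ⊗ H ⟶ V} {c : V ⟶ V ⊗ H} {b : W ⊗ H ⟶ W} {d : W ⟶ W ⊗ H}

/-- A right action becomes a left action of the opposite algebra. -/
theorem opAct_mul (hV : IsCrossed a c) :
    H ◁ ((β_ V H).inv ≫ a) ≫ (β_ V H).inv ≫ a =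
      (α_ H H V).inv ≫ ((β_ H H).inv ≫ μ[H]) ▷ V ≫ (β_ V H).inv ≫ a := by
  have h1 := assoc_iff.2 hV.act_mul
  have h2 : H ◁ (β_ V H).inv ≫ (β_ (V ⊗ H) H).inv ≫ (α_ V H H).hom =
      (α_ H H V).inv ≫ (β_ H H).inv ▷ V ≫ (β_ V (H ⊗ H)).inv := by
    rw [BraidedCategory.braiding_inv_naturality_left]
    simp
  calc _ = H ◁ (β_ V H).inv ≫ (β_ (V ⊗ H) H).inv ≫ a ▷ H ≫ a := by
        rw [whiskerLeft_comp_assoc, BraidedCategory.braiding_inv_naturality_right_assoc]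
    _ = (H ◁ (β_ V H).inv ≫ (β_ (V ⊗ H) H).inv ≫ (α_ V H H).hom) ≫ V ◁ μ[H] ≫ a := by
        rw [h1]
        simp only [Category.assoc, Iso.hom_inv_id_assoc]
    _ = _ := by
        rw [h2, comp_whiskerRight_assoc]
        simp only [Category.assoc]
        simp only [BraidedCategory.braiding_inv_naturality_left_assoc]

theorem opAct_one (hV : IsCrossed a c) : η[H] ▷ V ≫ (β_ V H).inv ≫ a = (λ_ V).hom := by
  have h1 := mul_one_iff.2 hV.act_one
  rw [BraidedCategory.braiding_inv_naturality_left_assoc, h1]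
  simp

/-- If `k` and `l` are convolution inverse for the opposite multiplication, then the endomorphisms
of `W ⊗ V` that coact on `w` and let `l(w₁)`, respectively `k(w₁)`, act on `v` compose to the
identity. -/
theorem coact_opAct_comp (hV : IsCrossed a c) (hW : IsCrossed b d) {k l : H ⟶ H}
    (h : Δ[H] ≫ (k ⊗ₘ l) ≫ (β_ H H).inv ≫ μ[H] = ε[H] ≫ η[H]) :
    (d ▷ V ≫ (α_ _ _ _).hom ≫ W ◁ (l ▷ V ≫ (β_ V H).inv ≫ a)) ≫
      d ▷ V ≫ (α_ _ _ _).hom ≫ W ◁ (k ▷ V ≫ (β_ V H).inv ≫ a) = 𝟙 _ := by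
  have h1 := opAct_mul hV
  have h2 := opAct_one hV
  have h3 := coassoc_iff.2 hW.coact_comul
  have h4 := comul_counit_iff.2 hW.coact_counit
  generalize (β_ V H).inv ≫ a = a' at *
  have h5 : Δ[H] ▷ V ≫ (α_ H H V).hom ≫ H ◁ (l ▷ V ≫ a') ≫ k ▷ V ≫ a' = ε[H] ▷ V ≫ (λ_ V).hom := by
    have := congr($h ▷ V ≫ a')
    simp only [comp_whiskerRight, Category.assoc, h2] at this
    rw [← this, ← comp_whiskerRight_assoc (β_ H H).inv, (Iso.inv_comp_eq _).1 h1.symm,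
      MonoidalCategory.tensorHom_def']
    simp [whisker_exchange_assoc]
  have h6 : d ▷ V ≫ (α_ _ _ _).hom ≫ d ▷ (H ⊗ V) ≫ (α_ _ _ _).hom =
      d ▷ V ≫ (α_ _ _ _).hom ≫ W ◁ (Δ[H] ▷ V ≫ (α_ H H V).hom) := by
    have := congr($h3 ▷ V ≫ (α_ _ _ _).hom ≫ W ◁ (α_ _ _ _).hom)
    simpa using this.symm
  calc _ = (d ▷ V ≫ (α_ _ _ _).hom ≫ d ▷ (H ⊗ V) ≫ (α_ _ _ _).hom) ≫
        W ◁ (H ◁ (l ▷ V ≫ a') ≫ k ▷ V ≫ a') := by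
        rw [Category.assoc, Category.assoc, whisker_exchange_assoc]
        simp only [tensor_whiskerLeft, Category.assoc, whiskerLeft_comp, Iso.inv_hom_id_assoc]
    _ = (d ≫ W ◁ ε[H]) ▷ V ≫ (α_ _ _ _).hom ≫ W ◁ (λ_ V).hom := by
        rw [h6, Category.assoc, Category.assoc, ← whiskerLeft_comp, Category.assoc, h5]
        simp
    _ = _ := by
        rw [h4]
        simp

variable [IsIso 𝒮[H]]

/-- The braiding of crossed modules as an isomorphism. The inverse lets `S⁻¹(w₁)` act on `v`. -/
@[simps hom]
def crossBraidIso (hV : IsCrossed a c) (hW : IsCrossed b d) : V ⊗ W ≅ W ⊗ V where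
  hom := crossBraid a d
  inv := (d ▷ V ≫ (α_ _ _ _).hom ≫ W ◁ (inv 𝒮[H] ▷ V ≫ (β_ V H).inv ≫ a)) ≫ (β_ V W).inv
  hom_inv_id := by
    have := coact_opAct_comp hV hW (k := inv 𝒮[H]) (l := 𝟙 H) (by
      rw [tensorHom_id, comul_inv_antipode_left])
    simp only [id_whiskerRight, Category.id_comp] at this
    rw [crossBraid_eq, Category.assoc, ← Category.assoc _ _ (β_ V W).inv, this, Category.id_comp,
      Iso.hom_inv_id]
  inv_hom_id := by
    have := coact_opAct_comp hV hW (k := 𝟙 H) (l := inv 𝒮[H]) (by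
      rw [id_tensorHom, comul_inv_antipode_right])
    simp only [id_whiskerRight, Category.id_comp] at this
    rw [crossBraid_eq, Category.assoc, Iso.inv_hom_id_assoc, this]

end CrossBraid

/-! ### The invariants of the regular Hopf bimodule -/

section

variable {C : Type u} [Category.{v} C] [MonoidalCategory C] [BraidedCategory C]
variable {H : C} [HopfObj H]

theorem HopfBimodule.proj_regular : (HopfBimodule.regular H).proj = ε[H] ≫ η[H] :=
  HopfObj.antipode_left H

namespace InvariantSplitting

section Unit

variable (t : InvariantSplitting (HopfBimodule.regular H))

/-- The inclusion of the invariants of the regular Hopf bimodule, as a morphism to `H`; the type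
of `t.i` mentions `(HopfBimodule.regular H).pt` instead. -/
def unitI : t.inv ⟶ H := t.i

/-- The projection of the regular Hopf bimodule to its invariants, as a morphism from `H`. -/
def unitP : H ⟶ t.inv := t.p

theorem unitI_unitP : t.unitI ≫ t.unitP = 𝟙 t.inv := t.i_p

theorem unitI_unitP_assoc : type_of% (reassoc_of% @unitI_unitP) :=
  @(reassoc_of% @unitI_unitP)

theorem unitP_unitI : t.unitP ≫ t.unitI = ε[H] ≫ η[H] :=
  t.p_i.trans HopfBimodule.proj_regular

theorem unitP_unitI_assoc : type_of% (reassoc_of% @unitP_unitI) :=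
  @(reassoc_of% @unitP_unitI)

/-- The counit, restricted to the invariants of `H`. -/
def counit : t.inv ⟶ 𝟙_ C := t.unitI ≫ ε[H]

theorem unitP_counit : t.unitP ≫ t.counit = ε[H] := by
  simp [counit, unitP_unitI_assoc]

theorem counit_one : t.counit ≫ η[H] = t.unitI := by
  rw [counit, Category.assoc, ← unitP_unitI, unitI_unitP_assoc]

theorem counit_one_assoc : type_of% (reassoc_of% @counit_one) :=
  @(reassoc_of% @counit_one)

/-- The invariants of `H` form a unit object. -/
def unitIso : 𝟙_ C ≅ t.inv where
  hom := η[H] ≫ t.unitP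
  inv := t.counit
  hom_inv_id := by rw [Category.assoc, unitP_counit, BimonObj.one_counit]
  inv_hom_id := by rw [counit_one_assoc, unitI_unitP]

theorem act_counit : t.act ≫ t.counit = t.counit ▷ H ≫ (λ_ H).hom ≫ ε[H] := by
  change (t.unitI ▷ H ≫ μ[H] ≫ t.unitP) ≫ t.counit = _
  simp [unitP_counit, MonoidalCategory.tensorHom_def]
  simp [counit]

theorem coact_counit : t.coact ≫ t.counit ▷ H = t.counit ≫ η[H] ≫ (λ_ H).inv := by
  change (t.unitI ≫ Δ[H] ≫ t.unitP ▷ H) ≫ t.counit ▷ H = _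
  rw [counit_one_assoc]
  simp [← comp_whiskerRight, unitP_counit]

theorem act_counit_at (Z : C) :
    mulAt t.act Z ≫ counitAt t.counit Z = counitAt t.counit (H ⊗ Z) ≫ counitAt ε[H] Z := by
  have := congr((α_ _ _ _).inv ≫ $(t.act_counit) ▷ Z ≫ (λ_ _).hom)
  simpa [mulAt, counitAt] using this

theorem coact_counit_at (Z : C) :
    comulAt t.coact Z ≫ counitAt t.counit (H ⊗ Z) = counitAt t.counit Z ≫ oneAt η[H] Z := by
  have := congr($(t.coact_counit) ▷ Z ≫ (α_ _ _ _).hom ≫ (λ_ _).hom)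
  simp only [comp_whiskerRight, Category.assoc] at this
  simp only [comulAt, counitAt, oneAt, Category.assoc, ← associator_naturality_left_assoc] at this ⊢
  rw [this]
  monoidal

theorem whiskerLeft_counit_at (X : C) (Z : C) : (X ◁ t.counit ≫ (ρ_ X).hom) ▷ Z =
    (α_ _ _ _).hom ≫ X ◁ counitAt t.counit Z := by
  simp [counitAt]

/-- The morphism `X ⊗ inv H ⟶ X`, `x ⊗ v ↦ ε(v) x`. -/
def rightUnitorHom (X : HopfBimodule H) : X.tensor t.isCrossed ⟶ X where
  hom := X.pt ◁ t.counit ≫ (ρ_ X.pt).hom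
  actL_hom := by
    simp only [Category.assoc]
    rw [← whisker_exchange_assoc]
    simp
  actR_hom := by
    rw [IsCrossedHom.act_iff]
    intro Z
    simp only [whiskerLeft_counit_at, diagActR_at, Category.assoc, Iso.inv_hom_id_assoc]
    simp only [← whiskerLeft_comp_assoc X.pt, ← whiskerLeft_comp X.pt, t.act_counit_at,
      mulAt_nat X.actR]
    simp only [whiskerLeft_comp, Category.assoc]
    simp only [← whiskerLeft_comp_assoc X.pt, braidAt_whiskerLeft_counitAt_assoc]
    simp only [← counitAt_nat_assoc, comul_counit_at, Category.comp_id]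
  hom_coactL := by
    simp only [Category.assoc]
    rw [← rightUnitor_naturality, whisker_exchange_assoc]
    simp
  hom_coactR := by
    rw [IsCrossedHom.coact_iff]
    intro Z
    simp only [whiskerLeft_counit_at, diagCoactR_at, Category.assoc, Iso.inv_hom_id_assoc]
    simp only [← whiskerLeft_comp X.pt, ← counitAt_nat, braidAt_counitAt_assoc]
    simp only [whiskerLeft_comp, comulAt_nat_assoc X.coactR]
    simp only [← whiskerLeft_comp_assoc X.pt, t.coact_counit_at]
    simp only [whiskerLeft_comp, Category.assoc, ← comulAt_nat X.coactR,
      ← comulAt_nat_assoc X.coactR]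
    simp only [← whiskerLeft_comp X.pt, mul_one_at]
    simp

end Unit

end InvariantSplitting

end

/-! ### The unit and associativity constraints -/

section

variable {C : Type u} [Category.{v} C] [MonoidalCategory C] [BraidedCategory C]
variable {H : C} [HopfObj H]

namespace InvariantSplitting

/-- `X ⊗ inv H ≅ X`. -/
@[simps! hom inv_hom]
def rightUnitorIso (t : InvariantSplitting (HopfBimodule.regular H)) (X : HopfBimodule H) :
    X.tensor t.isCrossed ≅ X :=
  HopfBimodule.isoOfHom (t.rightUnitorHom X) ((ρ_ X.pt).inv ≫ X.pt ◁ t.unitIso.hom)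
    (by
      change (X.pt ◁ t.unitIso.inv ≫ (ρ_ X.pt).hom) ≫ (ρ_ X.pt).inv ≫ X.pt ◁ t.unitIso.hom = 𝟙 _
      simp [← whiskerLeft_comp])
    (by
      change ((ρ_ X.pt).inv ≫ X.pt ◁ t.unitIso.hom) ≫ X.pt ◁ t.unitIso.inv ≫ (ρ_ X.pt).hom = 𝟙 _
      rw [Category.assoc, ← whiskerLeft_comp_assoc]
      simp)

section

variable {Y : HopfBimodule H} (s : InvariantSplitting Y) {V : C} {a : V ⊗ H ⟶ V}
  {c : V ⟶ V ⊗ H} {h : IsCrossed a c} (r : InvariantSplitting (Y.tensor h)) (X : HopfBimodule H)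

theorem isCrossedHom_tensorIso_hom :
    IsCrossedHom (diagActR s.act a) (diagCoactR s.coact c) r.act r.coact (s.tensorIso r).hom :=
  IsCrossedHom.inv (f := (s.tensorIso r).symm) (isCrossedHom_tensorIso_inv s r)

/-- `(X ⊗ inv Y) ⊗ V ⟶ X ⊗ inv (Y ⊗ V)`. -/
def associatorHom : (X.tensor s.isCrossed).tensor h ⟶ X.tensor r.isCrossed where
  hom := (α_ X.pt s.inv V).hom ≫ X.pt ◁ (s.tensorIso r).hom
  actL_hom := by
    simp only [comp_whiskerRight, Category.assoc]
    rw [associator_naturality_left_assoc, ← whisker_exchange]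
    simp
  actR_hom := by
    have h1 := IsCrossedHom.diagActR_comp (f := 𝟙 X.pt) (a := X.actR) (a' := X.actR) (by simp)
      (isCrossedHom_tensorIso_hom s r).act
    have h2 := (IsCrossedHom.associator X.actR X.coactR s.act s.coact a c).act
    simp only [id_tensorHom] at h1
    rw [reassoc_of% h2, comp_whiskerRight_assoc, ← h1]
  hom_coactL := by
    simp only [comp_whiskerRight, Category.assoc]
    rw [whisker_exchange_assoc]
    simp
  hom_coactR := by
    have h1 := IsCrossedHom.comp_diagCoactR (f := 𝟙 X.pt) (c := X.coactR) (c' := X.coactR) (by simp)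
      (isCrossedHom_tensorIso_hom s r).coact
    have h2 := (IsCrossedHom.associator X.actR X.coactR s.act s.coact a c).coact
    simp only [id_tensorHom] at h1
    rw [comp_whiskerRight, ← reassoc_of% h2, Category.assoc]
    exact congr(_ ≫ $h1)

/-- The associativity constraint. -/
@[simps! hom inv_hom]
def associatorIso : (X.tensor s.isCrossed).tensor h ≅ X.tensor r.isCrossed :=
  HopfBimodule.isoOfHom (associatorHom s r X)
    (X.pt ◁ (s.tensorIso r).inv ≫ (α_ X.pt s.inv V).inv)
    (by
      change ((α_ X.pt s.inv V).hom ≫ X.pt ◁ (s.tensorIso r).hom) ≫ _ = 𝟙 _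
      rw [Category.assoc, ← whiskerLeft_comp_assoc, Iso.hom_inv_id]
      simp)
    (by
      change _ ≫ ((α_ X.pt s.inv V).hom ≫ X.pt ◁ (s.tensorIso r).hom) = 𝟙 _
      rw [Category.assoc, Iso.inv_hom_id_assoc, ← whiskerLeft_comp, Iso.inv_hom_id]
      simp)

end

end InvariantSplitting

end

/-! ### The monoidal category of Hopf bimodules -/

section

variable {C : Type u} [Category.{v} C] [MonoidalCategory C] [BraidedCategory C]
variable {H : C} [HopfObj H]

namespace InvariantSplitting

section

variable {X X' Y : HopfBimodule H} (s : InvariantSplitting X) (s' : InvariantSplitting X')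
  (t : InvariantSplitting Y)
  {V W : C} {a : V ⊗ H ⟶ V} {c : V ⟶ V ⊗ H} {h : IsCrossed a c}
  {b : W ⊗ H ⟶ W} {d : W ⟶ W ⊗ H} {k : IsCrossed b d}

/-- On the invariants, `f ⊗ φ` is the tensor product of the restriction of `f` with `φ`. -/
theorem map_tensorMap (r : InvariantSplitting (X.tensor h)) (r' : InvariantSplitting (X'.tensor k))
    (f : X ⟶ X') {φ : V ⟶ W} (hφ : IsCrossedHom a c b d φ) :
    r.map r' (HopfBimodule.tensorMap f hφ) =
      (s.tensorIso r).inv ≫ (s.map s' f ⊗ₘ φ) ≫ (s'.tensorIso r').hom := by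
  rw [map, ← s.tensorIso_inv_i r, ← s'.p_tensorIso_hom r']
  simp [map, MonoidalCategory.tensorHom_def, whisker_exchange_assoc]

/-- On the invariants, the associativity constraint is the one of `C`. -/
theorem map_associatorHom (r : InvariantSplitting (Y.tensor h))
    (q : InvariantSplitting (X.tensor t.isCrossed)) (q' : InvariantSplitting (X.tensor r.isCrossed))
    (w : InvariantSplitting ((X.tensor t.isCrossed).tensor h)) :
    w.map q' (associatorHom t r X) = (q.tensorIso w).inv ≫ (s.tensorIso q).inv ▷ V ≫
      (α_ _ _ _).hom ≫ s.inv ◁ (t.tensorIso r).hom ≫ (s.tensorIso q').hom := by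
  rw [map, ← q.tensorIso_inv_i w, ← s.tensorIso_inv_i q, ← s.p_tensorIso_hom q']
  change _ ≫ ((α_ X.pt t.inv V).hom ≫ X.pt ◁ (t.tensorIso r).hom) ≫ _ = _
  have : s.i ▷ t.inv ▷ V ≫ (α_ X.pt t.inv V).hom ≫ s.p ▷ (t.inv ⊗ V) = (α_ _ _ _).hom := by
    rw [← associator_naturality_left, ← comp_whiskerRight_assoc, ← comp_whiskerRight]
    simp
  simp only [comp_whiskerRight, Category.assoc, whisker_exchange_assoc]
  rw [reassoc_of% this]

/-- On the invariants, the left unit constraint is the one of `C`. -/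
theorem map_leftUnitorHom (t : InvariantSplitting (HopfBimodule.regular H))
    (r : InvariantSplitting ((HopfBimodule.regular H).tensor s.isCrossed)) :
    r.map s s.leftUnitorHom = (t.tensorIso r).inv ≫ t.counit ▷ s.inv ≫ (λ_ _).hom := by
  rw [map, ← t.tensorIso_inv_i r, Category.assoc]
  change _ ≫ t.unitI ▷ s.inv ≫ (H ◁ s.i ≫ X.actL) ≫ s.p = _
  rw [Category.assoc, s.actL_p, whisker_exchange_assoc, counit]
  simp

/-- On the invariants, the right unit constraint is the one of `C`. -/
theorem map_rightUnitorHom (t : InvariantSplitting (HopfBimodule.regular H))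
    (r : InvariantSplitting (X.tensor t.isCrossed)) :
    r.map s (t.rightUnitorHom X) = (s.tensorIso r).inv ≫ s.inv ◁ t.counit ≫ (ρ_ _).hom := by
  rw [map, ← s.tensorIso_inv_i r, Category.assoc]
  change _ ≫ s.i ▷ t.inv ≫ (X.pt ◁ t.counit ≫ (ρ_ X.pt).hom) ≫ s.p = _
  simp [← whisker_exchange_assoc]

end

end InvariantSplitting

namespace HopfBimodule

variable (s : ∀ X : HopfBimodule H, InvariantSplitting X)

/-- The tensor product `X ⊗ inv Y` of Hopf bimodules with its constraints. -/
@[reducible]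
def monoidalStruct : MonoidalCategoryStruct (HopfBimodule H) where
  tensorObj X Y := X.tensor (s Y).isCrossed
  whiskerLeft X _ _ f := tensorMap (𝟙 X) ((s _).isCrossedHom_map (s _) f)
  whiskerRight f Y := tensorMap f (IsCrossedHom.id (s Y).act (s Y).coact)
  tensorHom f g := tensorMap f ((s _).isCrossedHom_map (s _) g)
  tensorUnit := regular H
  associator X Y _ := (s Y).associatorIso (s _) X
  leftUnitor X := (s X).leftUnitorIso
  rightUnitor X := (s _).rightUnitorIso X

/-- The functor sending a Hopf bimodule to its invariants. -/
@[simps]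
def invariants : HopfBimodule H ⥤ C where
  obj X := (s X).inv
  map f := (s _).map (s _) f
  map_comp f g := InvariantSplitting.map_comp _ _ _ f g

instance : (invariants s).Faithful where
  map_injective h := InvariantSplitting.map_injective _ _ h

/-- The functor of invariants carries the tensor product and the constraints of Hopf bimodules to
those of `C`. -/
def inducingFunctorData :
    letI := monoidalStruct s
    Monoidal.InducingFunctorData (invariants s) :=
  letI := monoidalStruct s
  { μIso X Y := (s X).tensorIso (s (X ⊗ Y))
    whiskerLeft_eq X _ _ f := by
      refine ((s _).map_tensorMap (s _) _ _ _ _).trans ?_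
      simp only [InvariantSplitting.map_id, id_tensorHom]
      rfl
    whiskerRight_eq f Y := by
      refine ((s _).map_tensorMap (s _) _ _ _ _).trans ?_
      simp only [tensorHom_id]
      rfl
    tensorHom_eq f g := (s _).map_tensorMap (s _) _ _ _ _
    εIso := (s (regular H)).unitIso
    associator_eq X Y Z := by
      refine ((s X).map_associatorHom (s Y) (s _) (s (X ⊗ Y)) (s _) (s _)).trans ?_
      change _ = (_ ≫ (_ ⊗ₘ 𝟙 _)) ≫ _ ≫ (𝟙 _ ⊗ₘ _) ≫ _
      simp only [id_tensorHom, tensorHom_id]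
      exact (Category.assoc _ _ _).symm
    leftUnitor_eq X := by
      refine ((s X).map_leftUnitorHom (s (regular H)) (s _)).trans ?_
      change _ = (_ ≫ (_ ⊗ₘ 𝟙 _)) ≫ _
      simp only [tensorHom_id]
      exact (Category.assoc _ _ _).symm
    rightUnitor_eq X := by
      refine ((s X).map_rightUnitorHom (s (regular H)) (s _)).trans ?_
      change _ = (_ ≫ (𝟙 _ ⊗ₘ _)) ≫ _
      simp only [id_tensorHom]
      exact (Category.assoc _ _ _).symm }

/-- The monoidal category of Hopf bimodules. -/
@[reducible]
def monoidalCategory : MonoidalCategory (HopfBimodule H) :=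
  letI := monoidalStruct s
  Monoidal.induced (invariants s) (inducingFunctorData s)

end HopfBimodule

end

/-! ### The braiding of Hopf bimodules -/

section

open Functor.OplaxMonoidal

variable {C : Type u} [Category.{v} C] [MonoidalCategory C]

/-- A braiding on a monoidal category `D`, from a faithful monoidal functor `F : D ⥤ C` and a
family of morphisms `F X ⊗ F Y ⟶ F Y ⊗ F X` satisfying the axioms of a braiding. The family need not
come from a braiding of `C`. -/
@[reducible]
def braidedOfFaithful {D : Type*} [Category* D] [MonoidalCategory D] (F : D ⥤ C) [F.Monoidal]
    [F.Faithful] (b : ∀ X Y : D, X ⊗ Y ≅ Y ⊗ X)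
    (t : ∀ X Y : D, F.obj X ⊗ F.obj Y ⟶ F.obj Y ⊗ F.obj X)
    (map_b : ∀ X Y, F.map (b X Y).hom = δ F X Y ≫ t X Y ≫ Functor.LaxMonoidal.μ F Y X)
    (naturality_right : ∀ (X : D) {Y Z : D} (f : Y ⟶ Z),
      F.obj X ◁ F.map f ≫ t X Z = t X Y ≫ F.map f ▷ F.obj X)
    (naturality_left : ∀ {X Y : D} (f : X ⟶ Y) (Z : D),
      F.map f ▷ F.obj Z ≫ t Y Z = t X Z ≫ F.obj Z ◁ F.map f)
    (tensor_right : ∀ X Y Z : D, F.obj X ◁ Functor.LaxMonoidal.μ F Y Z ≫ t X (Y ⊗ Z) =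
      (α_ _ _ _).inv ≫ t X Y ▷ F.obj Z ≫ (α_ _ _ _).hom ≫ F.obj Y ◁ t X Z ≫ (α_ _ _ _).inv ≫
        Functor.LaxMonoidal.μ F Y Z ▷ F.obj X)
    (tensor_left : ∀ X Y Z : D, Functor.LaxMonoidal.μ F X Y ▷ F.obj Z ≫ t (X ⊗ Y) Z =
      (α_ _ _ _).hom ≫ F.obj X ◁ t Y Z ≫ (α_ _ _ _).inv ≫ t X Z ▷ F.obj Y ≫ (α_ _ _ _).hom ≫
        F.obj Z ◁ Functor.LaxMonoidal.μ F X Y) :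
    BraidedCategory D where
  braiding := b
  braiding_naturality_right X Y Z f := F.map_injective (by
    simp only [Functor.map_comp, Functor.Monoidal.map_whiskerLeft,
      Functor.Monoidal.map_whiskerRight, map_b, Category.assoc, Functor.Monoidal.μ_δ_assoc,
      reassoc_of% naturality_right])
  braiding_naturality_left f Z := F.map_injective (by
    simp only [Functor.map_comp, Functor.Monoidal.map_whiskerLeft,
      Functor.Monoidal.map_whiskerRight, map_b, Category.assoc, Functor.Monoidal.μ_δ_assoc,
      reassoc_of% naturality_left])
  hexagon_forward X Y Z := F.map_injective (by
    simp only [Functor.map_comp, Functor.Monoidal.map_whiskerLeft,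
      Functor.Monoidal.map_whiskerRight, map_b, Category.assoc, whiskerLeft_comp, comp_whiskerRight,
      Functor.Monoidal.μ_δ_assoc, Functor.Monoidal.whiskerLeft_μ_δ_assoc,
      Functor.Monoidal.whiskerRight_μ_δ_assoc, Functor.Monoidal.map_associator,
      reassoc_of% tensor_right, Iso.hom_inv_id_assoc, Iso.inv_hom_id_assoc])
  hexagon_reverse X Y Z := F.map_injective (by
    simp only [Functor.map_comp, Functor.Monoidal.map_whiskerLeft,
      Functor.Monoidal.map_whiskerRight, map_b, Category.assoc, whiskerLeft_comp, comp_whiskerRight,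
      Functor.Monoidal.μ_δ_assoc, Functor.Monoidal.whiskerLeft_μ_δ_assoc,
      Functor.Monoidal.whiskerRight_μ_δ_assoc, Functor.Monoidal.map_associator_inv,
      reassoc_of% tensor_left, Iso.hom_inv_id_assoc, Iso.inv_hom_id_assoc])

end

section

variable {C : Type u} [Category.{v} C] [MonoidalCategory C] [BraidedCategory C]
variable {H : C} [HopfObj H]

namespace InvariantSplitting

variable {X Y : HopfBimodule H} (s : InvariantSplitting X) (t : InvariantSplitting Y)

section

variable {U V : C} {a : V ⊗ H ⟶ V} {c : V ⟶ V ⊗ H} {h : IsCrossed a c} {e : U ⊗ H ⟶ U}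
  {d : U ⟶ U ⊗ H} (r : InvariantSplitting (X.tensor h))

/-- The hexagon identity in the second variable, for the invariants of `X ⊗ V`. -/
theorem tensorIso_crossBraid_right (k : IsCrossed e d) :
    U ◁ (s.tensorIso r).hom ≫ crossBraid e r.coact = (α_ _ _ _).inv ≫ crossBraid e s.coact ▷ V ≫
      (α_ _ _ _).hom ≫ s.inv ◁ crossBraid e c ≫ (α_ _ _ _).inv ≫ (s.tensorIso r).hom ▷ U := by
  rw [whiskerLeft_crossBraid _ (s.isCrossedHom_tensorIso_hom r).coact, crossBraid_diagCoactR k]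
  simp only [Category.assoc]

/-- The hexagon identity in the first variable, for the invariants of `X ⊗ V`. -/
theorem tensorIso_crossBraid_left (k : IsCrossed e d) :
    (s.tensorIso r).hom ▷ U ≫ crossBraid r.act d = (α_ _ _ _).hom ≫ s.inv ◁ crossBraid a d ≫
      (α_ _ _ _).inv ≫ crossBraid s.act d ▷ V ≫ (α_ _ _ _).hom ≫ U ◁ (s.tensorIso r).hom := by
  rw [whiskerRight_crossBraid _ (s.isCrossedHom_tensorIso_hom r).act, crossBraid_diagActR k]
  simp only [Category.assoc]

end

/-- An isomorphism of the invariants that is a morphism of crossed modules comes from an isomorphism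
of Hopf bimodules. -/
@[simps]
def liftIso (e : s.inv ≅ t.inv) (h : IsCrossedHom s.act s.coact t.act t.coact e.hom) : X ≅ Y where
  hom := s.lift t h
  inv := t.lift s h.inv
  hom_inv_id := s.map_injective s (by rw [map_comp s t, map_lift, map_lift]; simp)
  inv_hom_id := t.map_injective t (by rw [map_comp t s, map_lift, map_lift]; simp)

variable [IsIso 𝒮[H]] (r : InvariantSplitting (X.tensor t.isCrossed))
  (r' : InvariantSplitting (Y.tensor s.isCrossed))

/-- The braiding of Hopf bimodules, lifted from the braiding of their invariants as crossed
modules. -/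
def braidIso : X.tensor t.isCrossed ≅ Y.tensor s.isCrossed :=
  r.liftIso r' ((s.tensorIso r).symm ≪≫ crossBraidIso s.isCrossed t.isCrossed ≪≫ t.tensorIso r')
    ((s.isCrossedHom_tensorIso_inv r).comp
      ((isCrossedHom_crossBraid s.isCrossed t.isCrossed).comp (t.isCrossedHom_tensorIso_hom r')))

theorem map_braidIso : r.map r' (s.braidIso t r r').hom =
    (s.tensorIso r).inv ≫ crossBraid s.act t.coact ≫ (t.tensorIso r').hom :=
  r.map_lift r' _

/-- The explicit formula `x ⊗ v ↦ x₋₁ v₀ ⊗ p(x₀ v₁)` for the braiding, where `v₀ ⊗ v₁` is the right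
coaction of `Y` on `i(v)`. -/
theorem braidIso_hom_hom : (s.braidIso t r r').hom.hom =
    (X.coactL ⊗ₘ (t.i ≫ Y.coactR)) ≫ tensorμ H X.pt Y.pt H ≫ (Y.actL ⊗ₘ (X.actR ≫ s.p)) := by
  refine (r.lift_hom r' _).trans ?_
  change (X.coactL ▷ t.inv ≫ (α_ _ _ _).hom) ≫
    H ◁ (r.p ≫ ((s.tensorIso r).inv ≫ crossBraid s.act t.coact ≫ (t.tensorIso r').hom) ≫ r'.i) ≫
      (α_ _ _ _).inv ≫ Y.actL ▷ s.inv = _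
  have h : r.p ≫ ((s.tensorIso r).inv ≫ crossBraid s.act t.coact ≫ (t.tensorIso r').hom) ≫ r'.i =
      X.pt ◁ t.i ≫ crossBraid X.actR Y.coactR ≫ Y.pt ◁ s.p := by
    simp only [Category.assoc, tensorIso_hom_i, p_tensorIso_inv_assoc]
    rw [whiskerRight_crossBraid_assoc _ s.p_act.symm, whiskerLeft_crossBraid_assoc _ t.i_coactR,
      whisker_exchange]
  rw [h, MonoidalCategory.tensorHom_def, MonoidalCategory.tensorHom_def' Y.actL]
  simp only [crossBraid, tensorμ]
  simp

end InvariantSplitting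

namespace HopfBimodule

variable [IsIso 𝒮[H]] (s : ∀ X : HopfBimodule H, InvariantSplitting X)

/-- The braided monoidal category of Hopf bimodules. -/
@[reducible]
def braidedCategory :
    letI := monoidalCategory s
    BraidedCategory (HopfBimodule H) :=
  letI := monoidalStruct s
  letI := monoidalCategory s
  letI : (invariants s).Monoidal := Monoidal.fromInducedMonoidal _ (inducingFunctorData s)
  braidedOfFaithful (invariants s)
    (fun X Y => (s X).braidIso (s Y) (s _) (s _))
    (fun X Y => crossBraid (s X).act (s Y).coact)
    (fun X Y => (s X).map_braidIso (s Y) (s _) (s _))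
    (fun _ Y Z f => whiskerLeft_crossBraid _ ((s Y).isCrossedHom_map (s Z) f).coact)
    (fun {X Y} f _ => whiskerRight_crossBraid _ ((s X).isCrossedHom_map (s Y) f).act)
    (fun X Y _ => (s Y).tensorIso_crossBraid_right (s _) (s X).isCrossed)
    (fun X _ Z => (s X).tensorIso_crossBraid_left (s _) (s Z).isCrossed)

end HopfBimodule

end

end BraidedHopf

end

theorem mainTheorem11 {C : Type u} [Category.{v} C] [MonoidalCategory C] [BraidedCategory C]
    [IsIdempotentComplete C] (H : C) [HopfObj H] [IsIso 𝒮[H]] :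
    (∀ X : BraidedHopf.HopfBimodule H, Nonempty (BraidedHopf.InvariantSplitting X)) ∧
    ∀ s : (∀ X : BraidedHopf.HopfBimodule H, BraidedHopf.InvariantSplitting X),
      ∃ (hT : ∀ X Y : BraidedHopf.HopfBimodule H,
          (BraidedHopf.tensorData X (s Y)).IsHopfBimodule)
        (M : MonoidalCategory (BraidedHopf.HopfBimodule H))
        (B : BraidedCategory (BraidedHopf.HopfBimodule H)),
        BraidedHopf.BraidedTensorData.of M B = BraidedHopf.BraidedTensorData.hopf s hT := by
  refine ⟨fun X => ?_, fun s => ?_⟩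
  · obtain ⟨V, i, p, h₁, h₂⟩ := IsIdempotentComplete.idempotents_split X.pt X.proj X.proj_proj
    exact ⟨⟨V, i, p, h₂, h₁⟩⟩
  · refine ⟨fun X Y => BraidedHopf.isHopfBimodule_tensor X (s Y).isCrossed,
      BraidedHopf.HopfBimodule.monoidalCategory s, BraidedHopf.HopfBimodule.braidedCategory s, ?_⟩
    have hb : ∀ X Y : BraidedHopf.HopfBimodule H, _ := fun X Y =>
      (s X).braidIso_hom_hom (s Y) (s (X.tensor (s Y).isCrossed)) (s (Y.tensor (s X).isCrossed))
    unfold BraidedHopf.BraidedTensorData.of BraidedHopf.BraidedTensorData.hopf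
    -- All components other than the braiding agree by definition.
    congr 1
    funext X Y
    exact hb X Y
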